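/- For a partition $\lambda$ let $S_\lambda$ be the Schur function and, for $\mu\subseteq\lambda$, let $S_{\lambda/\mu}$ be the skew Schur function, $S_{\lambda/\mu}(x_1,\dots,x_n)=\sum_T x^T$ over the semistandard tableaux $T$ of shape $\lambda/\mu$ with entries in $\{1,\dots,n\}$; let $\lambda'$ be the conjugate partition and $(\lambda/\mu)'=\lambda'/\mu'$. Let $$DS_\lambda=\sum_{\mu\subseteq\lambda}S_\mu\,S_{(\lambda/\mu)'} .$$ Let $n,m\ge 0$. Every symmetric polynomial $f\in\mathbb C[x_1,\dots,x_n]^{\mathfrak S_n}$ is uniquely $f=\sum_\lambda m_\lambda S_\lambda(x_1,\dots,x_n)$, a finite sum over partitions $\lambda$ with at most $n$ parts; put $$Df(y_1,\dots,y_m)=\sum_\lambda m_\lambda\,DS_\lambda(y_1,\dots,y_m).$$ Let $\langle\cdot,\cdot\rangle$ be the bilinear form on symmetric polynomials in $x_1,\dots,x_n$ for which the Schur polynomials $S_\lambda(x_1,\dots,x_n)$, $\lambda$ with at most $n$ parts, are orthonormal, extended coefficientwise to formal power series in $y_1,\dots,y_m$ with coefficients symmetric polynomials in $x_1,\dots,x_n$.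 **Theorem 2.11.** Let $f(x_1,\dots,x_n)$ be symmetric. Then, as formal power series in $y_1,\dots,y_m$, $$Df(y_1,\dots,y_m)=\Big\langle f,\ \prod_{i=1}^n\prod_{j=1}^m(1+x_iy_j)(1-x_iy_j)^{-1}\Big\rangle ,$$ and, for all $y_1,\dots,y_m\in\mathbb C$ with $|y_j|<1$, the following integral converges absolutely and $$Df(y_1,\dots,y_m)=\oint_T f(x_1,\dots,x_n)\prod_{i=1}^n\prod_{j=1}^m\frac{x_i+y_j}{x_i-y_j}\,d\nu ,$$ where $T=\{|x_1|=\dots=|x_n|=1\}$ and $$d\nu=(2\pi\sqrt{-1})^{-n}(n!)^{-1}\prod_{1\le i\ne j\le n}\Big(1-\frac{x_i}{x_j}\Big)\frac{dx_1}{x_1}\wedge\dots\wedge\frac{dx_n}{x_n}.$$ -/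

import Mathlib

open scoped BigOperators

namespace DoublySymmetric

noncomputable section

/-! ### Schur polynomials of (skew) shapes, through semistandard tableaux

A partition is a `YoungDiagram`; the cell `(i, j)` lies in row `i` and column `j`, so that the
number of parts of `lam` is `lam.colLen 0`.  The conjugate partition is `lam.transpose`. -/

/-- The cells of the skew shape `lam / mu`. -/
abbrev SkewCell (lam mu : YoungDiagram) : Type :=
  {c : ℕ × ℕ // c ∈ lam.cells \ mu.cells}

/-- A filling of `lam / mu` is semistandard if its entries weakly increase along rows and strictly
increase down columns. -/
def IsSemistandard {lam mu : YoungDiagram} {n : ℕ} (T : SkewCell lam mu → Fin n) : Prop :=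
  (∀ c d : SkewCell lam mu, c.1.1 = d.1.1 → c.1.2 ≤ d.1.2 → T c ≤ T d) ∧
  (∀ c d : SkewCell lam mu, c.1.2 = d.1.2 → c.1.1 < d.1.1 → T c < T d)

open Classical in
/-- The skew Schur polynomial `S_{lam/mu}(x_1, …, x_n)`, the sum of `x^T` over all semistandard
tableaux `T` of shape `lam / mu` with entries among `n` letters. -/
def skewSchur (lam mu : YoungDiagram) (n : ℕ) : MvPolynomial (Fin n) ℂ :=
  ∑ T : SkewCell lam mu → Fin n with IsSemistandard T, ∏ c, MvPolynomial.X (T c)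

/-- The Schur polynomial `S_lam(x_1, …, x_n)`. -/
def schur (lam : YoungDiagram) (n : ℕ) : MvPolynomial (Fin n) ℂ :=
  skewSchur lam ⊥ n

/-- There are finitely many diagrams contained in a given one. -/
theorem finite_Iic (lam : YoungDiagram) : (Set.Iic lam).Finite := by
  refine Set.Finite.of_finite_image (f := YoungDiagram.cells) ?_ ?_
  · refine (Finset.finite_toSet lam.cells.powerset).subset ?_
    rintro _ ⟨mu, hmu, rfl⟩
    exact Finset.mem_coe.2 (Finset.mem_powerset.2 (YoungDiagram.cells_subset_iff.2 hmu))
  · intro a _ b _ h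
    exact YoungDiagram.ext h

/-- The doubly Schur polynomial
`DS_lam(y_1, …, y_m) = ∑_{mu ⊆ lam} S_mu(y) S_{(lam/mu)'}(y)`, where `(lam/mu)' = lam'/mu'`. -/
def doublySchur (lam : YoungDiagram) (m : ℕ) : MvPolynomial (Fin m) ℂ :=
  ∑ mu ∈ (finite_Iic lam).toFinset, schur mu m * skewSchur lam.transpose mu.transpose m

/-! ### Schur expansion, the map `D` and the inner product -/

/-- The algebra of symmetric polynomials in `n` variables. -/
abbrev Sym (n : ℕ) : Subalgebra ℂ (MvPolynomial (Fin n) ℂ) :=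
  MvPolynomial.symmetricSubalgebra (Fin n) ℂ

/-- Partitions with at most `n` parts. -/
abbrev PartsLE (n : ℕ) : Type := {lam : YoungDiagram // lam.colLen 0 ≤ n}

/-- The linear combination `∑ c_lam S_lam(x_1, …, x_n)`. -/
def schurComb (n : ℕ) : (PartsLE n →₀ ℂ) →ₗ[ℂ] MvPolynomial (Fin n) ℂ :=
  Finsupp.linearCombination ℂ fun lam : PartsLE n => schur lam.1 n

/-- The coefficients `m_lam` of a symmetric polynomial `f = ∑ m_lam S_lam(x_1, …, x_n)`, where
`lam` has at most `n` parts.  (These Schur polynomials are a basis of the symmetric polynomials, so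
that on symmetric polynomials any left inverse of `schurComb n` is its inverse.) -/
def schurCoeff (n : ℕ) : Sym n →ₗ[ℂ] (PartsLE n →₀ ℂ) :=
  (schurComb n).leftInverse ∘ₗ (Sym n).val.toLinearMap

/-- `Df(y_1, …, y_m)`: the linear extension of `S_lam ↦ DS_lam(y_1, …, y_m)`. -/
def doubling (n m : ℕ) : Sym n →ₗ[ℂ] MvPolynomial (Fin m) ℂ :=
  (Finsupp.linearCombination ℂ fun lam : PartsLE n => doublySchur lam.1 m) ∘ₗ schurCoeff n

/-- The (bilinear) inner product of symmetric polynomials in `n` variables, for which the Schur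
polynomials `S_lam(x_1, …, x_n)` with at most `n` parts are orthonormal. -/
def schurInner (n : ℕ) (f g : Sym n) : ℂ :=
  (schurCoeff n f).sum fun lam a => a * schurCoeff n g lam

/-! ### The kernel -/

/-- `∏_{i ≤ n, j ≤ m} (1 + x_i y_j) (1 - x_i y_j)⁻¹`, as a formal power series in
`y_1, …, y_m` whose coefficients are polynomials in `x_1, …, x_n`. -/
def kernel (n m : ℕ) : MvPowerSeries (Fin m) (MvPolynomial (Fin n) ℂ) :=
  ∏ i : Fin n, ∏ j : Fin m,
    ((1 + MvPowerSeries.C (MvPolynomial.X i) * MvPowerSeries.X j) *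
      MvPowerSeries.invOfUnit (1 - MvPowerSeries.C (MvPolynomial.X i) * MvPowerSeries.X j) 1)

theorem map_invOfUnit_one {σ R S : Type*} [CommRing R] [CommRing S] (g : R →+* S)
    (a : MvPowerSeries σ R) (ha : MvPowerSeries.constantCoeff a = 1) :
    MvPowerSeries.map g (MvPowerSeries.invOfUnit a 1) =
      MvPowerSeries.invOfUnit (MvPowerSeries.map g a) 1 := by
  have h1 : MvPowerSeries.map g a * MvPowerSeries.map g (MvPowerSeries.invOfUnit a 1) = 1 := by
    rw [← map_mul, MvPowerSeries.mul_invOfUnit a 1 (by simpa using ha), map_one]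
  have h2 : MvPowerSeries.invOfUnit (MvPowerSeries.map g a) 1 * MvPowerSeries.map g a = 1 := by
    apply MvPowerSeries.invOfUnit_mul
    simp [ha]
  exact (left_inv_eq_right_inv h2 h1).symm

/-- The coefficients of the kernel are symmetric in `x_1, …, x_n`. -/
theorem coeff_kernel_isSymmetric (n m : ℕ) (α : Fin m →₀ ℕ) :
    (MvPowerSeries.coeff α (kernel n m)).IsSymmetric := by
  intro e
  have h : MvPowerSeries.map (MvPolynomial.rename (R := ℂ) e).toRingHom (kernel n m) =
      kernel n m := by
    unfold kernel
    rw [map_prod]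
    refine Fintype.prod_equiv e _ _ fun i => ?_
    rw [map_prod]
    refine Finset.prod_congr rfl fun j _ => ?_
    rw [map_mul, map_invOfUnit_one _ _ (by simp)]
    simp
  conv_rhs => rw [← h]
  simp

/-- The coefficient of `y^α` in the kernel, a symmetric polynomial in `x_1, …, x_n`. -/
def kernelCoeff (n m : ℕ) (α : Fin m →₀ ℕ) : Sym n :=
  ⟨MvPowerSeries.coeff α (kernel n m), coeff_kernel_isSymmetric n m α⟩

/-- `⟨f, ∏ (1 + x_i y_j) (1 - x_i y_j)⁻¹⟩`: the inner product is taken with respect to the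
variables `x` and coefficientwise in the variables `y`. -/
def innerKernel (n m : ℕ) (f : Sym n) : MvPowerSeries (Fin m) ℂ :=
  fun α => schurInner n f (kernelCoeff n m α)

/-! ### The Weyl measure on the torus -/

/-- The density of the Weyl measure `ν` with respect to `dx_1 ∧ ⋯ ∧ dx_n`, namely
`(2π√-1)^{-n} (n!)^{-1} ∏_{i ≠ j} (1 - x_i / x_j) ∏_i x_i^{-1}`. -/
def weylDensity (n : ℕ) (x : Fin n → ℂ) : ℂ :=
  ((2 * Real.pi * Complex.I) ^ n)⁻¹ * ((n.factorial : ℂ))⁻¹ *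
    (∏ i, ∏ j, if i = j then 1 else (1 - x i / x j)) * ∏ i, (x i)⁻¹

/-- The function integrated over the torus `|x_i| = 1`:
`f(x) ∏_{i,j} (x_i + y_j) / (x_i - y_j)` times the density of the Weyl measure. -/
def weylIntegrand (n m : ℕ) (f : Sym n) (y : Fin m → ℂ) (x : Fin n → ℂ) : ℂ :=
  MvPolynomial.eval x f.1 * (∏ i, ∏ j, (x i + y j) / (x i - y j)) * weylDensity n x

end

end DoublySymmetric

/-! The theorem rests on a Cauchy identity: ∏ (1 + x_i y_j)/(1 - x_i y_j) = ∑ S_λ(x) DS_λ(y), over λ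
with at most n parts. Pairing with f replaces each S_λ by DS_λ, which is the first formula; Weyl
orthogonality turns the pairing into an integral, which is the second.

Write δ = (n-1, …, 1, 0) and let a_α be the alternant det (x_i ^ α_j). Multiplication by a_δ makes a
symmetric series alternating, and an alternating series is determined by its coefficients at the
exponents λ + δ (`IsAlt.eq_zero`). Since S_λ a_δ = a_{λ+δ} (`alternant_expo_eq`), the Schur
coefficient of f at λ is the coefficient of f a_δ at λ + δ (`schurCoeff_apply`). Multiplying an
alternating series by ∏ 1/(1 - y x_i) or ∏ (1 + y x_i) acts on these coefficients by sums over
horizontal or vertical strips (`coeff_expo_mul_hSeries`, `coeff_expo_mul_eSeries`). A tableau is a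
chain of horizontal strips (`skewSchurAt_succ`), so iterating over the y_j yields skew Schur
polynomials in y: the first kind of factor produces S_μ(y), the second S_{(λ/μ)'}(y), together
DS_λ(y) (`coeff_expo_alternant_mul_kernel`).

For the integral, (x + y)/(x - y) = (1 + y x⁻¹)/(1 - y x⁻¹), and up to constants and ∏ x_i⁻¹ the
Weyl density is a_δ(x) a_δ(x⁻¹). The kernel is expanded in y inside the Banach algebra of bounded
continuous functions of the angles, where |y_j| < 1 gives absolute convergence. The mean over the
torus is a continuous functional, so it applies term by term, and each term is an inner product by
`torusMean_mul_vandermondePoly`. -/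

namespace DoublySymmetric

noncomputable section

/-! ### Tableaux as chains of horizontal strips -/

/-- `lam / nu` is a horizontal strip. -/
def HStrip (lam nu : YoungDiagram) : Prop :=
  nu ≤ lam ∧ ∀ i j, (i + 1, j) ∈ lam → (i, j) ∈ nu

/-- The diagrams contained in `lam`. -/
def below (lam : YoungDiagram) : Finset YoungDiagram := (finite_Iic lam).toFinset

@[simp] theorem mem_below {lam mu : YoungDiagram} : mu ∈ below lam ↔ mu ≤ lam := by
  simp [below]

open Classical in
/-- The diagrams `nu` such that `lam / nu` is a horizontal strip. -/
def hstrips (lam : YoungDiagram) : Finset YoungDiagram := (below lam).filter (HStrip lam)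

@[simp] theorem mem_hstrips {lam nu : YoungDiagram} : nu ∈ hstrips lam ↔ HStrip lam nu := by
  simp only [hstrips, Finset.mem_filter, mem_below, and_iff_right_iff_imp]
  exact fun h => h.1

variable {R : Type*} [CommRing R]

open Classical in
/-- The value of the skew Schur polynomial of `lam / mu` at `z`. -/
def skewSchurAt (lam mu : YoungDiagram) {n : ℕ} (z : Fin n → R) : R :=
  ∑ T : SkewCell lam mu → Fin n with IsSemistandard T, ∏ c, z (T c)

theorem skewSchur_eq (lam mu : YoungDiagram) (n : ℕ) :
    skewSchur lam mu n = skewSchurAt lam mu MvPolynomial.X := rfl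

theorem map_skewSchurAt {S : Type*} [CommRing S] (g : R →+* S) (lam mu : YoungDiagram) {n : ℕ}
    (z : Fin n → R) : g (skewSchurAt lam mu z) = skewSchurAt lam mu (fun i => g (z i)) := by
  simp [skewSchurAt]

theorem skewSchurAt_self (lam : YoungDiagram) {n : ℕ} (z : Fin n → R) :
    skewSchurAt lam lam z = 1 := by
  have : IsEmpty (SkewCell lam lam) := ⟨fun c => by simpa using c.2⟩
  unfold skewSchurAt
  rw [Finset.sum_filter, Fintype.sum_unique, if_pos]
  · simp
  · exact ⟨fun c => isEmptyElim c, fun c => isEmptyElim c⟩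

theorem skewSchurAt_zero {lam mu : YoungDiagram} (h : mu ≤ lam) (hne : mu ≠ lam) (z : Fin 0 → R) :
    skewSchurAt lam mu z = 0 := by
  have : ∃ c, c ∈ lam.cells \ mu.cells := by
    by_contra! hc
    apply hne
    refine le_antisymm h ?_
    rw [← YoungDiagram.cells_subset_iff, ← Finset.sdiff_eq_empty_iff_subset]
    exact Finset.eq_empty_of_forall_notMem hc
  obtain ⟨c, hc⟩ := this
  have : IsEmpty (SkewCell lam mu → Fin 0) := ⟨fun T => (T ⟨c, hc⟩).elim0⟩
  simp [skewSchurAt]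

/-- A skew shape contains the corner `(i, l)` between two comparable cells `(i, j)` and `(k, l)`, so
one can move along the row and then down the column. -/
theorem IsSemistandard.mono {lam mu : YoungDiagram} {n : ℕ} {T : SkewCell lam mu → Fin n}
    (hT : IsSemistandard T) {c d : SkewCell lam mu} (h : c.1 ≤ d.1) : T c ≤ T d := by
  obtain ⟨⟨i, j⟩, hc⟩ := c
  obtain ⟨⟨k, l⟩, hd⟩ := d
  obtain ⟨hik, hjl⟩ : i ≤ k ∧ j ≤ l := h
  have hc' := Finset.mem_sdiff.1 hc
  have hd' := Finset.mem_sdiff.1 hd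
  have he : (i, l) ∈ lam.cells \ mu.cells :=
    Finset.mem_sdiff.2 ⟨lam.up_left_mem hik le_rfl hd'.1,
      fun h => hc'.2 (mu.up_left_mem le_rfl hjl h)⟩
  refine (hT.1 ⟨_, hc⟩ ⟨_, he⟩ rfl hjl).trans ?_
  rcases hik.eq_or_lt with rfl | hlt
  · exact le_rfl
  · exact (hT.2 ⟨_, he⟩ ⟨_, hd⟩ rfl hlt).le

open Classical in
/-- The cells of `mu` and those of `lam / mu` whose entry is not the largest letter. -/
def innerDiagram {lam mu : YoungDiagram} {n : ℕ}
    (T : SkewCell lam mu → Fin (n + 1)) (hT : IsSemistandard T) : YoungDiagram where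
  cells := lam.cells.filter fun c => ∀ h : c ∈ lam.cells \ mu.cells, T ⟨c, h⟩ ≠ Fin.last n
  isLowerSet := by
    intro a b hba ha
    simp only [Finset.coe_filter, Set.mem_ofPred_eq] at ha ⊢
    refine ⟨lam.isLowerSet hba ha.1, fun hb => ?_⟩
    have hb' := Finset.mem_sdiff.1 hb
    have ha' : a ∈ lam.cells \ mu.cells :=
      Finset.mem_sdiff.2 ⟨ha.1, fun h => hb'.2 (mu.isLowerSet hba h)⟩
    have h1 : T ⟨b, hb⟩ ≤ T ⟨a, ha'⟩ := hT.mono hba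
    exact (h1.trans_lt (Fin.lt_last_iff_ne_last.2 (ha.2 ha'))).ne

theorem mem_innerDiagram {lam mu : YoungDiagram} {n : ℕ}
    (T : SkewCell lam mu → Fin (n + 1)) (hT : IsSemistandard T) (c : ℕ × ℕ) :
    c ∈ innerDiagram T hT ↔
      c ∈ lam ∧ ∀ h : c ∈ lam.cells \ mu.cells, T ⟨c, h⟩ ≠ Fin.last n := by
  rw [← YoungDiagram.mem_cells]
  simp only [innerDiagram, Finset.mem_filter, YoungDiagram.mem_cells]

theorem le_innerDiagram {lam mu : YoungDiagram} (hle : mu ≤ lam) {n : ℕ}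
    (T : SkewCell lam mu → Fin (n + 1)) (hT : IsSemistandard T) :
    mu ≤ innerDiagram T hT := by
  intro c hc
  have hc' : c ∈ mu := hc
  change c ∈ innerDiagram T hT
  rw [mem_innerDiagram]
  exact ⟨hle hc, fun h => absurd hc' (Finset.mem_sdiff.1 h).2⟩

/-- Strictness down columns allows the largest letter only in the bottom cell of a column. -/
theorem hStrip_innerDiagram {lam mu : YoungDiagram} {n : ℕ}
    (T : SkewCell lam mu → Fin (n + 1)) (hT : IsSemistandard T) :
    HStrip lam (innerDiagram T hT) := by
  refine ⟨fun c hc => ((mem_innerDiagram T hT c).1 hc).1, fun i j hij => ?_⟩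
  rw [mem_innerDiagram]
  refine ⟨lam.up_left_mem (Nat.le_succ i) le_rfl hij, fun h => ?_⟩
  have h' : (i + 1, j) ∈ lam.cells \ mu.cells :=
    Finset.mem_sdiff.2 ⟨hij, fun hm =>
      (Finset.mem_sdiff.1 h).2 (mu.up_left_mem (Nat.le_succ i) le_rfl hm)⟩
  exact ((hT.2 ⟨_, h⟩ ⟨_, h'⟩ rfl (Nat.lt_succ_self i)).trans_le (Fin.le_last _)).ne

open Classical in
/-- Extend a filling of `nu / mu` to `lam / mu` by a new largest letter. -/
def extendFilling (lam : YoungDiagram) {nu mu : YoungDiagram} {n : ℕ}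
    (T : SkewCell nu mu → Fin n) (c : SkewCell lam mu) : Fin (n + 1) :=
  if h : c.1 ∈ nu.cells then
    (T ⟨c.1, Finset.mem_sdiff.2 ⟨h, (Finset.mem_sdiff.1 c.2).2⟩⟩).castSucc
  else Fin.last n

theorem extendFilling_isSemistandard {lam nu mu : YoungDiagram} (h : HStrip lam nu) {n : ℕ}
    {T : SkewCell nu mu → Fin n} (hT : IsSemistandard T) :
    IsSemistandard (extendFilling lam T) := by
  constructor
  · rintro ⟨⟨i, j⟩, hc⟩ ⟨⟨k, l⟩, hd⟩ (rfl : i = k) (hjl : j ≤ l)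
    by_cases hd' : (i, l) ∈ nu.cells
    · have hc' : (i, j) ∈ nu.cells := nu.up_left_mem le_rfl hjl hd'
      simp only [extendFilling, hd', hc', dif_pos, Fin.castSucc_le_castSucc_iff]
      exact hT.1 _ _ rfl hjl
    · simp only [extendFilling, hd', dif_neg, not_false_iff]
      exact Fin.le_last _
  · rintro ⟨⟨i, j⟩, hc⟩ ⟨⟨k, l⟩, hd⟩ (rfl : j = l) (hik : i < k)
    have hc' : (i, j) ∈ nu.cells :=
      h.2 i j (lam.up_left_mem hik le_rfl (Finset.mem_sdiff.1 hd).1)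
    by_cases hd' : (k, j) ∈ nu.cells
    · simp only [extendFilling, hd', hc', dif_pos, Fin.castSucc_lt_castSucc_iff]
      exact hT.2 _ _ rfl hik
    · simp only [extendFilling, hd', hc', dif_pos, dif_neg, not_false_iff]
      exact Fin.castSucc_lt_last _

theorem prod_extendFilling {lam nu mu : YoungDiagram} (h : nu ≤ lam) (h' : mu ≤ nu) {n : ℕ}
    (T : SkewCell nu mu → Fin n) (z : Fin (n + 1) → R) :
    ∏ c, z (extendFilling lam T c) =
      (∏ c, z (T c).castSucc) * z (Fin.last n) ^ (lam.card - nu.card) := by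
  classical
  have key : ∀ c : SkewCell lam mu, z (extendFilling lam T c) =
      if h : c.1 ∈ nu.cells then
        z (T ⟨c.1, Finset.mem_sdiff.2 ⟨h, (Finset.mem_sdiff.1 c.2).2⟩⟩).castSucc
      else z (Fin.last n) := by
    intro c
    unfold extendFilling
    split_ifs <;> rfl
  simp only [key]
  rw [Fintype.prod_dite]
  congr 1
  · refine Fintype.prod_bijective
      (fun a : {a : SkewCell lam mu // a.1 ∈ nu.cells} =>
        (⟨a.1.1, Finset.mem_sdiff.2 ⟨a.2, (Finset.mem_sdiff.1 a.1.2).2⟩⟩ : SkewCell nu mu))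
      ⟨fun a b hab => ?_, fun c => ?_⟩ _ _ fun a => rfl
    · refine Subtype.ext (Subtype.ext ?_)
      simpa using hab
    · exact ⟨⟨⟨c.1, Finset.mem_sdiff.2 ⟨h (Finset.mem_sdiff.1 c.2).1,
        (Finset.mem_sdiff.1 c.2).2⟩⟩, (Finset.mem_sdiff.1 c.2).1⟩, rfl⟩
  · rw [Finset.prod_const, Finset.card_univ]
    congr 1
    rw [YoungDiagram.card, YoungDiagram.card, ← Finset.card_sdiff_of_subset
      (YoungDiagram.cells_subset_iff.2 h), ← Fintype.card_coe]
    refine Fintype.card_congr ⟨fun a => ⟨a.1.1, Finset.mem_sdiff.2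
      ⟨(Finset.mem_sdiff.1 a.1.2).1, a.2⟩⟩, fun c => ⟨⟨c.1, Finset.mem_sdiff.2
      ⟨(Finset.mem_sdiff.1 c.2).1, fun hm => (Finset.mem_sdiff.1 c.2).2 (h' hm)⟩⟩,
      (Finset.mem_sdiff.1 c.2).2⟩, fun _ => rfl, fun _ => rfl⟩

/-- Branching rule. Tableaux are grouped by the diagram `nu` left after deleting the cells with the
largest letter; within a group, deletion and `extendFilling` are inverse to each other, and the
deleted cells contribute a power of the last variable. -/
theorem skewSchurAt_succ {lam mu : YoungDiagram} (hle : mu ≤ lam) {n : ℕ} (z : Fin (n + 1) → R)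
    [DecidablePred (mu ≤ ·)] :
    skewSchurAt lam mu z = ∑ nu ∈ (hstrips lam).filter (mu ≤ ·),
      skewSchurAt nu mu (fun i => z i.castSucc) * z (Fin.last n) ^ (lam.card - nu.card) := by
  classical
  unfold skewSchurAt
  -- The value `⊥` is never used: only semistandard fillings are summed.
  rw [← Finset.sum_fiberwise_of_maps_to
    (g := fun T => if hT : IsSemistandard T then innerDiagram T hT else ⊥)
    (t := (hstrips lam).filter (mu ≤ ·))]
  · refine Finset.sum_congr rfl fun nu hnu => ?_
    obtain ⟨hnu, hmu⟩ := Finset.mem_filter.1 hnu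
    rw [mem_hstrips] at hnu
    rw [Finset.sum_mul]
    symm
    refine Finset.sum_bij (fun T _ => extendFilling lam T) ?_ ?_ ?_ ?_
    · intro T hT
      have hT' := extendFilling_isSemistandard hnu (Finset.mem_filter.1 hT).2
      simp only [Finset.mem_filter, Finset.mem_univ, true_and]
      refine ⟨hT', ?_⟩
      rw [dif_pos hT']
      ext c
      simp only [YoungDiagram.mem_cells]
      rw [mem_innerDiagram]
      constructor
      · rintro ⟨h1, h2⟩
        by_contra hc
        exact h2 (Finset.mem_sdiff.2 ⟨h1, fun hm => hc (hmu hm)⟩)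
          (by simp only [extendFilling]; exact dif_neg hc)
      · intro hc
        refine ⟨hnu.1 hc, fun h => ?_⟩
        have hc' : c ∈ nu.cells := hc
        simp only [extendFilling, hc', dif_pos]
        exact (Fin.castSucc_lt_last _).ne
    · intro T _ T' _ hTT'
      funext c
      have := congrFun hTT' ⟨c.1, Finset.mem_sdiff.2 ⟨hnu.1 (Finset.mem_sdiff.1 c.2).1,
        (Finset.mem_sdiff.1 c.2).2⟩⟩
      simp only [extendFilling, (Finset.mem_sdiff.1 c.2).1, dif_pos] at this
      exact Fin.castSucc_injective _ this
    · intro T hT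
      simp only [Finset.mem_filter, Finset.mem_univ, true_and] at hT
      obtain ⟨hT, hin⟩ := hT
      rw [dif_pos hT] at hin
      have hsub : ∀ c : SkewCell nu mu, c.1 ∈ lam.cells \ mu.cells := fun c =>
        Finset.mem_sdiff.2 ⟨hnu.1 (Finset.mem_sdiff.1 c.2).1, (Finset.mem_sdiff.1 c.2).2⟩
      have hlast : ∀ c : SkewCell nu mu, T ⟨c.1, hsub c⟩ ≠ Fin.last n := by
        intro c
        have hc : c.1 ∈ nu := (Finset.mem_sdiff.1 c.2).1
        have hc' : c.1 ∈ innerDiagram T hT := hin ▸ hc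
        exact ((mem_innerDiagram T hT c.1).1 hc').2 _
      refine ⟨fun c => (T ⟨c.1, hsub c⟩).castPred (hlast c), ?_, ?_⟩
      · simp only [Finset.mem_filter, Finset.mem_univ, true_and]
        refine ⟨fun c d h1 h2 => ?_, fun c d h1 h2 => ?_⟩
        · exact Fin.castPred_le_castPred_iff.2 (hT.1 _ _ h1 h2)
        · exact Fin.castPred_lt_castPred_iff.2 (hT.2 _ _ h1 h2)
      · funext c
        by_cases hc : c.1 ∈ nu.cells
        · simp only [extendFilling, hc, dif_pos, Fin.castSucc_castPred]
        · simp only [extendFilling, hc, dif_neg, not_false_iff]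
          have hc' : c.1 ∉ innerDiagram T hT := by rw [hin]; exact hc
          rw [mem_innerDiagram] at hc'
          by_contra hne
          exact hc' ⟨(Finset.mem_sdiff.1 c.2).1, fun _ => fun h => hne h.symm⟩
    · intro T _
      rw [prod_extendFilling hnu.1 hmu]
  · intro T hT
    have hT' := (Finset.mem_filter.1 hT).2
    rw [dif_pos hT']
    exact Finset.mem_filter.2 ⟨mem_hstrips.2 (hStrip_innerDiagram T hT'),
      le_innerDiagram hle T hT'⟩

/-- Iterating sums over horizontal strips gives skew Schur polynomials. -/
theorem sum_skewSchurAt_of_hstrips {P : YoungDiagram → Prop}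
    (hP : ∀ lam mu, mu ≤ lam → P lam → P mu) (m : ℕ) (y : Fin m → R)
    (Φ : ℕ → YoungDiagram → R)
    (hΦ : ∀ (j : Fin m) lam, P lam → Φ (j + 1) lam =
      ∑ nu ∈ hstrips lam, y j ^ (lam.card - nu.card) * Φ j nu)
    (lam : YoungDiagram) (hlam : P lam) :
    Φ m lam = ∑ mu ∈ below lam, skewSchurAt lam mu y * Φ 0 mu := by
  classical
  induction m generalizing lam with
  | zero =>
    -- Without letters only the empty shape has a tableau.
    rw [Finset.sum_eq_single lam, skewSchurAt_self, one_mul]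
    · intro mu hmu hne
      rw [skewSchurAt_zero (mem_below.1 hmu) hne, zero_mul]
    · simp
  | succ m ih =>
    have h1 := hΦ (Fin.last m) lam hlam
    rw [Fin.val_last] at h1
    rw [h1]
    have h2 : ∀ nu ∈ hstrips lam, y (Fin.last m) ^ (lam.card - nu.card) * Φ m nu =
        ∑ mu ∈ below nu, skewSchurAt nu mu (fun i => y i.castSucc) *
          y (Fin.last m) ^ (lam.card - nu.card) * Φ 0 mu := by
      intro nu hnu
      rw [ih (fun i => y i.castSucc) (fun j => hΦ j.castSucc) nu
        (hP _ _ (mem_hstrips.1 hnu).1 hlam), Finset.mul_sum]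
      exact Finset.sum_congr rfl fun mu _ => by ring
    rw [Finset.sum_congr rfl h2]
    rw [Finset.sum_comm' (t' := below lam) (s' := fun mu => (hstrips lam).filter (mu ≤ ·))]
    · refine Finset.sum_congr rfl fun mu hmu => ?_
      rw [skewSchurAt_succ (mem_below.1 hmu), Finset.sum_mul]
    · intro nu mu
      simp only [mem_hstrips, mem_below, Finset.mem_filter]
      exact ⟨fun h => ⟨h, h.2.trans h.1.1⟩, fun h => h.1⟩

end

end DoublySymmetric

/-! ### Exponents λ + δ, and generating series in separate variables -/

namespace DoublySymmetric

noncomputable section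

/-! ### Partitions and strictly decreasing exponents -/

/-- The diagram with row lengths `r`. -/
def diagramOfRows (r : ℕ → ℕ) (hr : Antitone r) (n : ℕ) : YoungDiagram where
  cells := (Finset.range n ×ˢ Finset.range (r 0)).filter fun c => c.2 < r c.1
  isLowerSet := by
    rintro ⟨i, j⟩ ⟨k, l⟩ ⟨hki, hlj⟩ h
    simp only [Finset.coe_filter, Finset.mem_product, Finset.mem_range, Set.mem_ofPred_eq] at *
    have h1 := hr hki
    have h2 := hr (Nat.zero_le k)
    exact ⟨⟨by omega, by omega⟩, by omega⟩

theorem rowLen_diagramOfRows (r : ℕ → ℕ) (hr : Antitone r) (n : ℕ) (h0 : r n = 0) (i : ℕ) :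
    (diagramOfRows r hr n).rowLen i = r i := by
  have key : ∀ j, j < (diagramOfRows r hr n).rowLen i ↔ j < r i := by
    intro j
    rw [← YoungDiagram.mem_iff_lt_rowLen, ← YoungDiagram.mem_cells]
    simp only [diagramOfRows, Finset.mem_filter, Finset.mem_product, Finset.mem_range]
    refine ⟨fun h => h.2, fun h => ⟨⟨?_, h.trans_le (hr (Nat.zero_le i))⟩, h⟩⟩
    by_contra! hn
    have := hr hn
    omega
  have h1 := key (r i)
  have h2 := key ((diagramOfRows r hr n).rowLen i)
  omega

theorem le_iff_rowLen {mu lam : YoungDiagram} :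
    mu ≤ lam ↔ ∀ i, mu.rowLen i ≤ lam.rowLen i := by
  constructor
  · intro h i
    by_contra! hlt
    have h1 : (i, lam.rowLen i) ∈ mu := YoungDiagram.mem_iff_lt_rowLen.2 hlt
    exact lt_irrefl _ (YoungDiagram.mem_iff_lt_rowLen.1 (h h1))
  · rintro h ⟨i, j⟩ hc
    exact YoungDiagram.mem_iff_lt_rowLen.2 ((YoungDiagram.mem_iff_lt_rowLen.1 hc).trans_le (h i))

theorem colLen_zero_le_iff {lam : YoungDiagram} {n : ℕ} :
    lam.colLen 0 ≤ n ↔ ∀ i, n ≤ i → lam.rowLen i = 0 := by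
  rw [← not_iff_not]
  push Not
  rw [← YoungDiagram.mem_iff_lt_colLen, YoungDiagram.mem_iff_lt_rowLen]
  refine ⟨fun h => ⟨n, le_rfl, h.ne'⟩, fun ⟨i, hi, h⟩ => ?_⟩
  exact (Nat.pos_of_ne_zero h).trans_le (lam.rowLen_anti n i hi)

theorem colLen_zero_mono {mu lam : YoungDiagram} (h : mu ≤ lam) {n : ℕ} (hl : lam.colLen 0 ≤ n) :
    mu.colLen 0 ≤ n := by
  rw [colLen_zero_le_iff] at *
  exact fun i hi => Nat.le_zero.1 ((le_iff_rowLen.1 h i).trans (hl i hi).le)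

/-- Horizontal strips as interlacing row lengths, the form in which they appear among exponents. -/
theorem hStrip_iff_rowLen {lam nu : YoungDiagram} :
    HStrip lam nu ↔ nu ≤ lam ∧ ∀ i, lam.rowLen (i + 1) ≤ nu.rowLen i := by
  refine and_congr_right fun _ => forall_congr' fun i => ?_
  simp only [YoungDiagram.mem_iff_lt_rowLen]
  refine ⟨fun h => ?_, fun h j hj => hj.trans_le h⟩
  by_contra! hlt
  exact lt_irrefl _ (h _ hlt)

/-- After transposition the strip is vertical: each row loses at most one cell, matching the 0/1
exponents of ∏ (1 + y x_i). -/
theorem hStrip_transpose_iff_rowLen {lam nu : YoungDiagram} :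
    HStrip lam.transpose nu.transpose ↔ nu ≤ lam ∧ ∀ i, lam.rowLen i ≤ nu.rowLen i + 1 := by
  unfold HStrip
  rw [YoungDiagram.transpose_le_iff]
  refine and_congr_right fun _ => ?_
  simp only [YoungDiagram.mem_transpose, Prod.swap_prod_mk]
  rw [forall_comm]
  refine forall_congr' fun i => ?_
  simp only [YoungDiagram.mem_iff_lt_rowLen]
  refine ⟨fun h => ?_, fun h j hj => by omega⟩
  by_contra! hlt
  exact lt_irrefl _ (h _ hlt)

theorem card_eq_sum_rowLen {lam : YoungDiagram} {n : ℕ} (h : lam.colLen 0 ≤ n) :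
    lam.card = ∑ i : Fin n, lam.rowLen i := by
  rw [YoungDiagram.card, Finset.card_eq_sum_card_fiberwise (f := Prod.fst) (t := Finset.range n),
    Finset.sum_range]
  · refine Finset.sum_congr rfl fun i _ => ?_
    rw [YoungDiagram.rowLen_eq_card]
    rfl
  · rintro ⟨i, j⟩ hc
    simp only [Finset.coe_range, Set.mem_Iio]
    by_contra! hi
    have h1 := YoungDiagram.mem_iff_lt_rowLen.1 ((YoungDiagram.mem_cells _).1 hc)
    rw [colLen_zero_le_iff.1 h i hi] at h1
    omega

/-- The exponent `lam + (n - 1, …, 1, 0)`. -/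
def expo (n : ℕ) (lam : YoungDiagram) : Fin n →₀ ℕ :=
  Finsupp.equivFunOnFinite.symm fun i => lam.rowLen i + (n - 1 - i)

@[simp] theorem expo_apply (n : ℕ) (lam : YoungDiagram) (i : Fin n) :
    expo n lam i = lam.rowLen i + (n - 1 - i) := rfl

theorem expo_strictAnti (n : ℕ) (lam : YoungDiagram) : StrictAnti (expo n lam) := by
  intro i j hij
  have h1 := lam.rowLen_anti i j (le_of_lt hij)
  have h2 : (i : ℕ) < j := hij
  simp only [expo_apply]
  omega

theorem expo_injOn (n : ℕ) : Set.InjOn (expo n) {lam | lam.colLen 0 ≤ n} := by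
  have key : ∀ lam mu : YoungDiagram, lam.colLen 0 ≤ n → expo n lam = expo n mu → lam ≤ mu := by
    intro lam mu hl h
    rw [le_iff_rowLen]
    intro i
    by_cases hi : i < n
    · have := DFunLike.congr_fun h ⟨i, hi⟩
      simp only [expo_apply] at this
      omega
    · rw [colLen_zero_le_iff.1 hl i (by omega)]
      exact Nat.zero_le _
  exact fun lam hl mu hm h => le_antisymm (key _ _ hl h) (key _ _ hm h.symm)

/-- Taken with `j` the last index, this shows that a strictly decreasing exponent dominates δ, so
that δ can be subtracted in ℕ without truncation. -/
theorem add_sub_le_of_strictAnti {n : ℕ} {γ : Fin n → ℕ} (h : StrictAnti γ) {i j : Fin n}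
    (hij : i ≤ j) : γ j + (j - i) ≤ γ i := by
  obtain ⟨j, hj⟩ := j
  obtain ⟨i, hi⟩ := i
  have hij' : i ≤ j := hij
  obtain ⟨k, rfl⟩ := Nat.exists_eq_add_of_le hij'
  clear hij hij'
  induction k with
  | zero => simp
  | succ k ih =>
    have h1 := ih (by omega)
    have h2 : γ ⟨i + (k + 1), hj⟩ < γ ⟨i + k, by omega⟩ := h (Fin.mk_lt_mk.2 (by omega))
    simp only at h1 ⊢
    omega

theorem exists_expo_eq {n : ℕ} {γ : Fin n →₀ ℕ} (h : StrictAnti γ) :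
    ∃ lam : YoungDiagram, lam.colLen 0 ≤ n ∧ expo n lam = γ := by
  set r : ℕ → ℕ := fun i => if h : i < n then γ ⟨i, h⟩ - (n - 1 - i) else 0 with hr
  have hge : ∀ i : Fin n, n - 1 - i ≤ γ i := by
    intro i
    have hi := i.2
    have h1 : i ≤ (⟨n - 1, by omega⟩ : Fin n) := by
      exact Fin.mk_le_mk.2 (by omega)
    have := add_sub_le_of_strictAnti h h1
    simp only at this
    omega
  have hanti : Antitone r := by
    refine antitone_nat_of_succ_le fun i => ?_
    simp only [hr]
    by_cases hi : i + 1 < n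
    · rw [dif_pos hi, dif_pos (by omega)]
      have : γ ⟨i + 1, hi⟩ < γ ⟨i, by omega⟩ := h (Fin.mk_lt_mk.2 (by omega))
      omega
    · rw [dif_neg hi]
      exact Nat.zero_le _
  have h0 : r n = 0 := by simp [hr]
  refine ⟨diagramOfRows r hanti n, ?_, ?_⟩
  · rw [colLen_zero_le_iff]
    intro i hi
    rw [rowLen_diagramOfRows r hanti n h0]
    simp only [hr]
    rw [dif_neg (by omega)]
  · ext i
    rw [expo_apply, rowLen_diagramOfRows r hanti n h0]
    simp only [hr]
    rw [dif_pos i.2]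
    have := hge i
    simp only [Fin.eta]
    omega

theorem degree_expo {lam : YoungDiagram} {n : ℕ} (h : lam.colLen 0 ≤ n) :
    (expo n lam).degree = lam.card + ∑ i : Fin n, (n - 1 - (i : ℕ)) := by
  rw [Finsupp.degree_eq_sum, card_eq_sum_rowLen h, ← Finset.sum_add_distrib]
  rfl

theorem degree_expo_sub {lam mu : YoungDiagram} {n : ℕ} (h : lam.colLen 0 ≤ n)
    (h' : mu ≤ lam) : (expo n lam).degree - (expo n mu).degree = lam.card - mu.card := by
  rw [degree_expo h, degree_expo (colLen_zero_mono h' h)]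
  omega

theorem expo_le_expo {lam mu : YoungDiagram} (n : ℕ) (h : mu ≤ lam) : expo n mu ≤ expo n lam := by
  intro i
  simp only [expo_apply]
  have := le_iff_rowLen.1 h i
  omega

theorem le_of_expo_le {lam mu : YoungDiagram} {n : ℕ} (hm : mu.colLen 0 ≤ n)
    (h : expo n mu ≤ expo n lam) : mu ≤ lam := by
  rw [le_iff_rowLen]
  intro i
  by_cases hi : i < n
  · have := h ⟨i, hi⟩
    simp only [expo_apply] at this
    omega
  · rw [colLen_zero_le_iff.1 hm i (by omega)]
    exact Nat.zero_le _

/-! ### Products of power series in separate variables -/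

open MvPowerSeries

variable {R : Type*} [CommRing R] {n : ℕ}

/-- The power series `∑ g_k x_i^k`. -/
def sepSeries (i : Fin n) (g : ℕ → R) : MvPowerSeries (Fin n) R :=
  fun β => if β.support ⊆ {i} then g (β i) else 0

theorem coeff_sepSeries (i : Fin n) (g : ℕ → R) (β : Fin n →₀ ℕ) :
    coeff β (sepSeries i g) = if β.support ⊆ {i} then g (β i) else 0 := rfl

/-- The factors involve disjoint variables, so the only splitting of `β` that can contribute
separates the coordinate at `a` from the others. -/
theorem coeff_prod_sepSeries (g : Fin n → ℕ → R) (s : Finset (Fin n)) (β : Fin n →₀ ℕ) :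
    coeff β (∏ i ∈ s, sepSeries i (g i)) =
      if β.support ⊆ s then ∏ i ∈ s, g i (β i) else 0 := by
  classical
  induction s using Finset.induction_on generalizing β with
  | empty => simp [coeff_one, Finset.subset_empty]
  | insert a s ha ih =>
    rw [Finset.prod_insert ha, coeff_mul,
      Finset.sum_eq_single (Finsupp.single a (β a), β.erase a)]
    · have h1 : (Finsupp.single a (β a)).support ⊆ {a} := Finsupp.support_single_subset
      rw [coeff_sepSeries, ih, if_pos h1, Finset.prod_insert ha, Finsupp.single_eq_same,
        Finsupp.support_erase]
      simp only [Finset.subset_insert_iff]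
      split_ifs
      · congr 1
        refine Finset.prod_congr rfl fun i hi => ?_
        rw [Finsupp.erase_ne (ne_of_mem_of_not_mem hi ha)]
      · simp
    · rintro ⟨p, q⟩ hpq hne
      rw [Finset.HasAntidiagonal.mem_antidiagonal] at hpq
      simp only at hpq
      rw [coeff_sepSeries, ih]
      split_ifs with hp hq
      · exfalso
        apply hne
        have hqa : q a = 0 := by
          by_contra h
          exact ha (hq (Finsupp.mem_support_iff.2 h))
        have hpa : p a = β a := by
          rw [← hpq, Finsupp.add_apply, hqa, add_zero]
        have hp' : p = Finsupp.single a (β a) := by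
          rw [← hpa]
          ext i
          by_cases hi : i = a
          · rw [hi, Finsupp.single_eq_same]
          · rw [Finsupp.single_eq_of_ne hi]
            by_contra h
            exact hi (Finset.mem_singleton.1 (hp (Finsupp.mem_support_iff.2 h)))
        rw [Prod.mk.injEq]
        refine ⟨hp', ?_⟩
        ext i
        by_cases hi : i = a
        · rw [hi, Finsupp.erase_same, hqa]
        · rw [Finsupp.erase_ne hi, ← hpq, Finsupp.add_apply, hp', Finsupp.single_eq_of_ne hi,
            zero_add]
      · rw [mul_zero]
      · rw [zero_mul]
      · rw [zero_mul]
    · intro h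
      exact absurd (Finset.HasAntidiagonal.mem_antidiagonal.2 (Finsupp.single_add_erase a β)) h

theorem coeff_prod_univ_sepSeries (g : Fin n → ℕ → R) (β : Fin n →₀ ℕ) :
    coeff β (∏ i, sepSeries i (g i)) = ∏ i, g i (β i) := by
  rw [coeff_prod_sepSeries, if_pos (Finset.subset_univ _)]

theorem C_mul_X_eq (i : Fin n) (y : R) :
    (C y * X i : MvPowerSeries (Fin n) R) = monomial (Finsupp.single i 1) y := by
  rw [X_def, ← monomial_zero_eq_C_apply, monomial_mul_monomial]
  simp

theorem one_add_C_mul_X_eq (i : Fin n) (y : R) :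
    (1 + C y * X i : MvPowerSeries (Fin n) R) =
      sepSeries i fun k => if k ≤ 1 then y ^ k else 0 := by
  classical
  ext β
  rw [C_mul_X_eq, map_add, coeff_one, coeff_monomial, coeff_sepSeries]
  by_cases h : β.support ⊆ {i}
  · obtain ⟨k, rfl⟩ : ∃ k, β = Finsupp.single i k := ⟨_, Finsupp.support_subset_singleton.1 h⟩
    rw [if_pos h, Finsupp.single_eq_same]
    simp only [Finsupp.single_eq_zero,
      (Finsupp.single_injective i).eq_iff]
    rcases k with _ | _ | k
    · simp
    · simp
    · simp
  · rw [if_neg h, if_neg, if_neg, add_zero]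
    · rintro rfl
      exact h Finsupp.support_single_subset
    · rintro rfl
      simp at h

theorem sepSeries_mul_one_sub (i : Fin n) (g : ℕ → R) (y : R) :
    sepSeries i g * (1 - C y * X i) =
      sepSeries i fun k => g k - if k = 0 then 0 else g (k - 1) * y := by
  classical
  ext β
  rw [C_mul_X_eq, mul_sub, mul_one, map_sub, coeff_mul_monomial, coeff_sepSeries,
    coeff_sepSeries, coeff_sepSeries]
  by_cases h : β.support ⊆ {i}
  · obtain ⟨k, rfl⟩ : ∃ k, β = Finsupp.single i k := ⟨_, Finsupp.support_subset_singleton.1 h⟩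
    rw [if_pos h, if_pos h, Finsupp.single_eq_same]
    rcases k with _ | k
    · simp
    · have h1 : Finsupp.single i 1 ≤ Finsupp.single i (k + 1) := by simp
      have h2 : Finsupp.single i (k + 1) - Finsupp.single i 1 = Finsupp.single i k := by
        rw [← Finsupp.single_tsub]; simp
      rw [if_pos h1, h2, if_pos Finsupp.support_single_subset, Finsupp.single_eq_same,
        if_neg (Nat.succ_ne_zero k), Nat.add_sub_cancel]
  · rw [if_neg h, if_neg h]
    split_ifs with h1 h2
    · exfalso
      apply h
      rw [← tsub_add_cancel_of_le h1]
      exact Finsupp.support_add.trans (Finset.union_subset h2 Finsupp.support_single_subset)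
    · simp
    · simp

theorem sepSeries_eq_one (i : Fin n) {g : ℕ → R} (h0 : g 0 = 1) (h : ∀ k ≠ 0, g k = 0) :
    sepSeries i g = 1 := by
  classical
  ext β
  rw [coeff_sepSeries, coeff_one]
  by_cases hβ : β.support ⊆ {i}
  · obtain ⟨k, rfl⟩ : ∃ k, β = Finsupp.single i k := ⟨_, Finsupp.support_subset_singleton.1 hβ⟩
    rw [if_pos hβ, Finsupp.single_eq_same]
    by_cases hk : k = 0
    · simp [hk, h0]
    · simp [hk, h k hk]
  · rw [if_neg hβ, if_neg]
    rintro rfl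
    simp at hβ

/-- The geometric series `1 / (1 - y x_i)`. -/
def geom (i : Fin n) (y : R) : MvPowerSeries (Fin n) R := sepSeries i (y ^ ·)

theorem geom_mul (i : Fin n) (y : R) : geom i y * (1 - C y * X i) = 1 := by
  rw [geom, sepSeries_mul_one_sub]
  refine sepSeries_eq_one i (by simp) fun k hk => ?_
  rw [if_neg hk, ← pow_succ, Nat.sub_add_cancel (Nat.pos_of_ne_zero hk), sub_self]

/-- Only the degree bound in `x_i` matters later: it limits the numerator of the Cauchy determinant
in `alternant_expo_eq`. -/
theorem exists_prod_one_sub_eq_sepSeries {ι : Type*} (i : Fin n) (y : ι → R) (s : Finset ι) :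
    ∃ g : ℕ → R, (∀ k, s.card < k → g k = 0) ∧
      ∏ k ∈ s, (1 - C (y k) * X i) = sepSeries i g := by
  classical
  induction s using Finset.induction_on with
  | empty =>
    exact ⟨fun k => if k = 0 then 1 else 0, fun k hk => if_neg (Nat.ne_of_gt hk),
      (sepSeries_eq_one i (g := fun k => if k = 0 then (1 : R) else 0) (if_pos rfl)
        fun k hk => if_neg hk).symm⟩
  | insert a s ha ih =>
    obtain ⟨g, hg, hs⟩ := ih
    refine ⟨_, fun k hk => ?_, by
      rw [Finset.prod_insert ha, hs, mul_comm, sepSeries_mul_one_sub]⟩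
    rw [Finset.card_insert_of_notMem ha] at hk
    rw [hg k (by omega), if_neg (by omega), hg (k - 1) (by omega)]
    simp

/-- `∏_i 1 / (1 - y x_i)`. -/
def hSeries (n : ℕ) (y : R) : MvPowerSeries (Fin n) R := ∏ i, geom i y

/-- `∏_i (1 + y x_i)`. -/
def eSeries (n : ℕ) (y : R) : MvPowerSeries (Fin n) R := ∏ i, (1 + C y * X i)

theorem coeff_hSeries (y : R) (β : Fin n →₀ ℕ) : coeff β (hSeries n y) = y ^ β.degree := by
  unfold hSeries geom
  rw [coeff_prod_univ_sepSeries, Finset.prod_pow_eq_pow_sum, Finsupp.degree_eq_sum]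

theorem coeff_eSeries (y : R) (β : Fin n →₀ ℕ) :
    coeff β (eSeries n y) = if ∀ i, β i ≤ 1 then y ^ β.degree else 0 := by
  unfold eSeries
  simp only [one_add_C_mul_X_eq]
  rw [coeff_prod_univ_sepSeries]
  split_ifs with h
  · rw [Finsupp.degree_eq_sum, ← Finset.prod_pow_eq_pow_sum]
    exact Finset.prod_congr rfl fun i _ => if_pos (h i)
  · push Not at h
    obtain ⟨i, hi⟩ := h
    exact Finset.prod_eq_zero (Finset.mem_univ i) (if_neg (by omega))

end

end DoublySymmetric

/-! ### Alternating series and the Pieri rules for their coefficients -/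

namespace DoublySymmetric

noncomputable section

open MvPowerSeries

variable {R : Type*} [CommRing R] {n : ℕ}

/-! ### Alternating power series -/

/-- Permuting the variables multiplies `F` by the sign. -/
def IsAlt (F : MvPowerSeries (Fin n) R) : Prop :=
  ∀ σ : Equiv.Perm (Fin n),
    rename σ F = ((Equiv.Perm.sign σ : ℤ) : MvPowerSeries (Fin n) R) * F

theorem coeff_intCast_mul (β : Fin n →₀ ℕ) (k : ℤ) (F : MvPowerSeries (Fin n) R) :
    coeff β ((k : MvPowerSeries (Fin n) R) * F) = (k : R) * coeff β F := by
  rw [← map_intCast (C : R →+* MvPowerSeries (Fin n) R), coeff_C_mul]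

theorem coeff_mapDomain_rename (σ : Equiv.Perm (Fin n)) (F : MvPowerSeries (Fin n) R)
    (γ : Fin n →₀ ℕ) : coeff (γ.mapDomain σ) (rename σ F) = coeff γ F := by
  have := coeff_embDomain_rename σ.toEmbedding F γ
  rw [Finsupp.embDomain_eq_mapDomain] at this
  exact this

theorem sign_mul_sign (σ : Equiv.Perm (Fin n)) :
    ((Equiv.Perm.sign σ : ℤ) : R) * ((Equiv.Perm.sign σ : ℤ) : R) = 1 := by
  rw [← Int.cast_mul, ← Units.val_mul, Int.units_mul_self]
  simp

theorem IsAlt.coeff_mapDomain {F : MvPowerSeries (Fin n) R} (hF : IsAlt F)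
    (σ : Equiv.Perm (Fin n)) (γ : Fin n →₀ ℕ) :
    coeff (γ.mapDomain σ) F = ((Equiv.Perm.sign σ : ℤ) : R) * coeff γ F := by
  rw [← coeff_mapDomain_rename σ F γ, hF σ, coeff_intCast_mul, ← mul_assoc, sign_mul_sign, one_mul]

theorem IsAlt.mul {F G : MvPowerSeries (Fin n) R} (hF : IsAlt F)
    (hG : ∀ σ : Equiv.Perm (Fin n), rename σ G = G) : IsAlt (F * G) := by
  intro σ
  rw [map_mul, hF, hG, mul_assoc]

theorem IsAlt.sub {F G : MvPowerSeries (Fin n) R} (hF : IsAlt F) (hG : IsAlt G) :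
    IsAlt (F - G) := by
  intro σ
  rw [map_sub, hF, hG, mul_sub]

theorem IsAlt.C_mul {F : MvPowerSeries (Fin n) R} (a : R) (hF : IsAlt F) : IsAlt (C a * F) := by
  intro σ
  rw [map_mul, hF, rename_C]
  ring

theorem mapDomain_perm_apply (γ : Fin n →₀ ℕ) (σ : Equiv.Perm (Fin n)) (i : Fin n) :
    γ.mapDomain σ i = γ (σ.symm i) :=
  Finsupp.mapDomain_equiv_apply _ _

theorem IsAlt.coeff_mapDomain_swap {F : MvPowerSeries (Fin n) R} (hF : IsAlt F) {a b : Fin n}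
    (hab : a ≠ b) (γ : Fin n →₀ ℕ) :
    coeff (γ.mapDomain (Equiv.swap a b)) F = -coeff γ F := by
  rw [hF.coeff_mapDomain, Equiv.Perm.sign_swap hab]
  simp

/-- The complex algebra structure serves to make 2 invertible. -/
theorem eq_zero_of_eq_neg [Algebra ℂ R] {x : R} (h : x = -x) : x = 0 := by
  have h2 : (2 : ℂ) • x = 0 := by
    rw [two_smul]
    nth_rewrite 1 [h]
    exact neg_add_cancel x
  have h3 : ((1 / 2 : ℂ) * 2) • x = 0 := by rw [mul_smul, h2, smul_zero]
  simpa using h3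

/-- Swapping two equal entries fixes the exponent but changes the sign of the coefficient. -/
theorem IsAlt.coeff_eq_zero [Algebra ℂ R] {F : MvPowerSeries (Fin n) R} (hF : IsAlt F)
    {γ : Fin n →₀ ℕ} (h : ¬ Function.Injective γ) : coeff γ F = 0 := by
  obtain ⟨a, b, hab, hne⟩ := Function.not_injective_iff.1 h
  apply eq_zero_of_eq_neg
  rw [← hF.coeff_mapDomain_swap hne]
  congr 2
  ext i
  rw [mapDomain_perm_apply, Equiv.symm_swap]
  by_cases hia : i = a
  · rw [hia, Equiv.swap_apply_left, hab]
  by_cases hib : i = b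
  · rw [hib, Equiv.swap_apply_right, hab]
  rw [Equiv.swap_apply_of_ne_of_ne hia hib]

theorem exists_perm_expo_eq {γ : Fin n →₀ ℕ} (h : Function.Injective γ) :
    ∃ (σ : Equiv.Perm (Fin n)) (lam : YoungDiagram), lam.colLen 0 ≤ n ∧
      (expo n lam).mapDomain σ = γ := by
  -- The order dual makes the sort decreasing.
  set σ := Tuple.sort (fun i => OrderDual.toDual (γ i))
  have h1 : Antitone fun i => γ (σ i) := fun i j hij =>
    Tuple.monotone_sort (fun i => OrderDual.toDual (γ i)) hij
  have h2 : StrictAnti (γ.mapDomain σ.symm) := by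
    have h3 : (γ.mapDomain σ.symm : Fin n → ℕ) = fun i => γ (σ i) := by
      funext i
      rw [mapDomain_perm_apply, Equiv.symm_symm]
    rw [h3]
    exact h1.strictAnti_of_injective (h.comp σ.injective)
  obtain ⟨lam, hl, he⟩ := exists_expo_eq h2
  refine ⟨σ, lam, hl, ?_⟩
  rw [he, ← Finsupp.mapDomain_comp]
  simp

/-- An exponent with a repeated entry has coefficient zero; every other one is a permutation of some
λ + δ. -/
theorem IsAlt.eq_zero [Algebra ℂ R] {F : MvPowerSeries (Fin n) R} (hF : IsAlt F)
    (h : ∀ lam : YoungDiagram, lam.colLen 0 ≤ n → coeff (expo n lam) F = 0) : F = 0 := by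
  ext γ
  by_cases hγ : Function.Injective γ
  · obtain ⟨σ, lam, hl, rfl⟩ := exists_perm_expo_eq hγ
    rw [hF.coeff_mapDomain, h lam hl, mul_zero, map_zero]
  · rw [hF.coeff_eq_zero hγ, map_zero]

theorem rename_eSeries (y : R) (σ : Equiv.Perm (Fin n)) :
    rename σ (eSeries n y) = eSeries n y := by
  unfold eSeries
  rw [map_prod]
  exact Fintype.prod_equiv σ _ _ fun i => by simp

theorem rename_geom (σ : Equiv.Perm (Fin n)) (i : Fin n) (y : R) :
    rename σ (geom i y) = geom (σ i) y := by
  have h1 : rename σ (geom i y) * (1 - C y * X (σ i)) = 1 := by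
    have := congrArg (rename σ) (geom_mul i y)
    simpa using this
  exact left_inv_eq_right_inv h1 (by rw [mul_comm, geom_mul])

theorem rename_hSeries (y : R) (σ : Equiv.Perm (Fin n)) :
    rename σ (hSeries n y) = hSeries n y := by
  unfold hSeries
  rw [map_prod]
  exact Fintype.prod_equiv σ _ _ fun i => rename_geom σ i y

/-! ### Pieri rules -/

/-- The coefficient at `x ^ (lam + (n - 1, …, 1, 0))` of `F * ∏ (1 + y x_i)`. -/
theorem coeff_expo_mul_eSeries [Algebra ℂ R] {F : MvPowerSeries (Fin n) R} (hF : IsAlt F) (y : R)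
    {lam : YoungDiagram} (hl : lam.transpose.colLen 0 ≤ n) :
    coeff (expo n lam.transpose) (F * eSeries n y) = ∑ mu ∈ hstrips lam,
      y ^ (lam.card - mu.card) * coeff (expo n mu.transpose) F := by
  classical
  have hcard : ∀ mu : YoungDiagram, mu.transpose.card = mu.card := by
    intro mu
    simp [YoungDiagram.card, YoungDiagram.transpose]
  rw [coeff_mul]
  symm
  have hmem : ∀ mu ∈ hstrips lam, mu.transpose ≤ lam.transpose ∧
      ∀ i, lam.transpose.rowLen i ≤ mu.transpose.rowLen i + 1 := by
    intro mu hmu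
    rw [← hStrip_transpose_iff_rowLen, YoungDiagram.transpose_transpose,
      YoungDiagram.transpose_transpose]
    exact mem_hstrips.1 hmu
  refine Finset.sum_of_injOn
    (fun mu => (expo n mu.transpose, expo n lam.transpose - expo n mu.transpose)) ?_ ?_ ?_ ?_
  · intro mu hmu mu' hmu' h
    have h1 := congrArg Prod.fst h
    have h2 := expo_injOn n (colLen_zero_mono (hmem mu hmu).1 hl)
      (colLen_zero_mono (hmem mu' hmu').1 hl) h1
    rwa [YoungDiagram.transpose_eq_iff] at h2
  · intro mu hmu
    have hmu := hmem mu hmu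
    simp only [Finset.mem_coe, Finset.HasAntidiagonal.mem_antidiagonal]
    exact add_tsub_cancel_of_le (expo_le_expo n hmu.1)
  · rintro ⟨γ, β⟩ hγβ himg
    rw [Finset.HasAntidiagonal.mem_antidiagonal] at hγβ
    simp only at hγβ ⊢
    rw [coeff_eSeries]
    split_ifs with hβ
    swap
    · rw [mul_zero]
    have hval : ∀ i, γ i + β i = expo n lam.transpose i := fun i => by rw [← hγβ]; rfl
    by_cases hinj : Function.Injective γ
    swap
    · rw [hF.coeff_eq_zero hinj, zero_mul]
    exfalso
    apply himg
    -- Subtracting 0 or 1 from each entry of a strictly decreasing sequence keeps it weakly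
    -- decreasing, and injectivity restores strictness.
    have hanti : StrictAnti γ := by
      refine Antitone.strictAnti_of_injective (fun i j hij => ?_) hinj
      rcases hij.eq_or_lt with rfl | hlt
      · exact le_rfl
      have h1 := expo_strictAnti n lam.transpose hlt
      have h2 := hval i
      have h3 := hval j
      have h4 := hβ i
      omega
    obtain ⟨mu, hm, he⟩ := exists_expo_eq hanti
    refine ⟨mu.transpose, ?_, ?_⟩
    · rw [Finset.mem_coe, mem_hstrips]
      have h1 : HStrip lam.transpose.transpose mu.transpose := by
        rw [hStrip_transpose_iff_rowLen]
        refine ⟨le_of_expo_le hm ?_, fun i => ?_⟩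
        · rw [he, ← hγβ]
          exact le_self_add
        · by_cases hi : i < n
          · have h2 := hval ⟨i, hi⟩
            rw [← he] at h2
            simp only [expo_apply] at h2
            have h4 := hβ ⟨i, hi⟩
            omega
          · rw [colLen_zero_le_iff.1 hl i (by omega)]
            exact Nat.zero_le _
      rwa [YoungDiagram.transpose_transpose] at h1
    · simp only [YoungDiagram.transpose_transpose, he, ← hγβ, add_tsub_cancel_left]
  · intro mu hmu
    have hmu := hmem mu hmu
    simp only
    have hdeg : (expo n lam.transpose - expo n mu.transpose).degree = lam.card - mu.card := by
      rw [← hcard lam, ← hcard mu, ← degree_expo_sub hl hmu.1]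
      nth_rewrite 2 [← add_tsub_cancel_of_le (expo_le_expo n hmu.1)]
      rw [map_add, add_tsub_cancel_left]
    rw [coeff_eSeries, if_pos, mul_comm, hdeg]
    · intro i
      simp only [Finsupp.tsub_apply, expo_apply]
      have := hmu.2 i
      omega

theorem coeff_mul_hSeries (F : MvPowerSeries (Fin n) R) (y : R) (L : Fin n →₀ ℕ) :
    coeff L (F * hSeries n y) =
      ∑ γ ∈ Finset.Iic L, y ^ (L.degree - γ.degree) * coeff γ F := by
  classical
  rw [coeff_mul]
  refine Finset.sum_bij' (fun p _ => p.1) (fun γ _ => (γ, L - γ)) ?_ ?_ ?_ ?_ ?_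
  · rintro ⟨γ, β⟩ h
    rw [Finset.HasAntidiagonal.mem_antidiagonal] at h
    simp [← h]
  · intro γ h
    rw [Finset.HasAntidiagonal.mem_antidiagonal]
    exact add_tsub_cancel_of_le (Finset.mem_Iic.1 h)
  · rintro ⟨γ, β⟩ h
    rw [Finset.HasAntidiagonal.mem_antidiagonal] at h
    simp [← h]
  · simp
  · rintro ⟨γ, β⟩ h
    rw [Finset.HasAntidiagonal.mem_antidiagonal] at h
    simp only at h ⊢
    rw [coeff_hSeries, ← h, map_add, add_tsub_cancel_left, mul_comm]

/-- The exponents that cancel in the product with `∏ 1 / (1 - y x_i)`. -/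
def Cancels (L γ : Fin n →₀ ℕ) (j : ℕ) : Prop :=
  ∃ h : j + 1 < n, γ ⟨j, Nat.lt_of_succ_lt h⟩ ≤ L ⟨j + 1, h⟩

/-- Sign-reversing involution: for the least `j` with γ_j ≤ L_{j+1}, swap the entries at `j` and `j
+ 1`. The result stays below `L`, since γ_{j+1} ≤ L_{j+1} ≤ L_j. Earlier entries are untouched, so
`j` is still least; the degree is kept and the coefficient of `F` changes sign. -/
theorem sum_cancels [Algebra ℂ R] {F : MvPowerSeries (Fin n) R} (hF : IsAlt F) (y : R)
    {L : Fin n →₀ ℕ} (hL : Antitone L) [DecidablePred fun γ => ∃ j, Cancels L γ j] :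
    ∑ γ ∈ (Finset.Iic L).filter (fun γ => ∃ j, Cancels L γ j),
      y ^ (L.degree - γ.degree) * coeff γ F = 0 := by
  classical
  have hj : ∀ γ ∈ (Finset.Iic L).filter (fun γ => ∃ j, Cancels L γ j), ∃ j, Cancels L γ j :=
    fun γ hγ => (Finset.mem_filter.1 hγ).2
  have hlt : ∀ γ hγ, Nat.find (hj γ hγ) + 1 < n := fun γ hγ => (Nat.find_spec (hj γ hγ)).1
  set σ : ∀ γ ∈ (Finset.Iic L).filter (fun γ => ∃ j, Cancels L γ j), Equiv.Perm (Fin n) :=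
    fun γ hγ => Equiv.swap ⟨Nat.find (hj γ hγ), Nat.lt_of_succ_lt (hlt γ hγ)⟩
      ⟨Nat.find (hj γ hγ) + 1, hlt γ hγ⟩ with hσ
  have hne : ∀ γ hγ, (⟨Nat.find (hj γ hγ), Nat.lt_of_succ_lt (hlt γ hγ)⟩ : Fin n) ≠
      ⟨Nat.find (hj γ hγ) + 1, hlt γ hγ⟩ := by
    intro γ hγ h
    have := congrArg Fin.val h
    simp at this
  have hle : ∀ (γ : Fin n →₀ ℕ) hγ, γ.mapDomain (σ γ hγ) ≤ L := by
    intro γ hγ i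
    have h0 := Finset.mem_Iic.1 (Finset.mem_filter.1 hγ).1
    rw [mapDomain_perm_apply, hσ, Equiv.symm_swap]
    by_cases h1 : i = ⟨Nat.find (hj γ hγ), Nat.lt_of_succ_lt (hlt γ hγ)⟩
    · rw [h1, Equiv.swap_apply_left]
      exact (h0 _).trans (hL (Fin.mk_le_mk.2 (Nat.le_succ _)))
    by_cases h2 : i = ⟨Nat.find (hj γ hγ) + 1, hlt γ hγ⟩
    · rw [h2, Equiv.swap_apply_right]
      exact (Nat.find_spec (hj γ hγ)).2
    · rw [Equiv.swap_apply_of_ne_of_ne h1 h2]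
      exact h0 i
  have hfind : ∀ (γ : Fin n →₀ ℕ) hγ, Cancels L (γ.mapDomain (σ γ hγ)) (Nat.find (hj γ hγ)) ∧
      ∀ k < Nat.find (hj γ hγ), ¬ Cancels L (γ.mapDomain (σ γ hγ)) k := by
    intro γ hγ
    have h0 := Finset.mem_Iic.1 (Finset.mem_filter.1 hγ).1
    refine ⟨⟨hlt γ hγ, ?_⟩, fun k hk ⟨h1, h2⟩ => ?_⟩
    · rw [mapDomain_perm_apply, hσ, Equiv.symm_swap, Equiv.swap_apply_left]
      exact h0 _
    · rw [mapDomain_perm_apply, hσ, Equiv.symm_swap, Equiv.swap_apply_of_ne_of_ne] at h2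
      · exact Nat.find_min (hj γ hγ) hk ⟨h1, h2⟩
      · rw [Ne, Fin.mk.injEq]
        omega
      · rw [Ne, Fin.mk.injEq]
        omega
  have hmem : ∀ (γ : Fin n →₀ ℕ) hγ, γ.mapDomain (σ γ hγ) ∈
      (Finset.Iic L).filter (fun γ => ∃ j, Cancels L γ j) := fun γ hγ =>
    Finset.mem_filter.2 ⟨Finset.mem_Iic.2 (hle γ hγ), _, (hfind γ hγ).1⟩
  refine Finset.sum_involution (fun γ hγ => γ.mapDomain (σ γ hγ)) ?_ ?_ hmem ?_
  · intro γ hγ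
    rw [Finsupp.degree_mapDomain, hF.coeff_mapDomain_swap (hne γ hγ)]
    ring
  -- At a fixed point the coefficient equals its own negative, so the term is already zero.
  · intro γ hγ h0 h1
    apply h0
    have h2 := hF.coeff_mapDomain_swap (hne γ hγ) γ
    simp only [hσ] at h1
    rw [h1] at h2
    rw [eq_zero_of_eq_neg h2, mul_zero]
  · intro γ hγ
    have h1 : Nat.find (hj _ (hmem γ hγ)) = Nat.find (hj γ hγ) :=
      (Nat.find_eq_iff _).2 (hfind γ hγ)
    have h2 : σ _ (hmem γ hγ) = σ γ hγ := by
      simp only [hσ, h1]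
    simp only [h2]
    rw [← Finsupp.mapDomain_comp]
    have h3 : (σ γ hγ : Fin n → Fin n) ∘ σ γ hγ = id := by
      funext i
      simp [hσ]
    rw [h3, Finsupp.mapDomain_id]

/-- The coefficient at `x ^ (lam + (n - 1, …, 1, 0))` of `F * ∏ 1 / (1 - y x_i)`. -/
theorem coeff_expo_mul_hSeries [Algebra ℂ R] {F : MvPowerSeries (Fin n) R} (hF : IsAlt F) (y : R)
    {lam : YoungDiagram} (hl : lam.colLen 0 ≤ n) :
    coeff (expo n lam) (F * hSeries n y) = ∑ mu ∈ hstrips lam,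
      y ^ (lam.card - mu.card) * coeff (expo n mu) F := by
  classical
  rw [coeff_mul_hSeries, ← Finset.sum_filter_add_sum_filter_not _
    (fun γ => ∃ j, Cancels (expo n lam) γ j),
    sum_cancels hF y (expo_strictAnti n lam).antitone, zero_add]
  symm
  refine Finset.sum_of_injOn (expo n) ?_ ?_ ?_ ?_
  · intro mu hmu mu' hmu' h
    exact expo_injOn n (colLen_zero_mono (mem_hstrips.1 hmu).1 hl)
      (colLen_zero_mono (mem_hstrips.1 hmu').1 hl) h
  · intro mu hmu
    have hmu := hStrip_iff_rowLen.1 (mem_hstrips.1 hmu)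
    simp only [Finset.coe_filter, Finset.mem_Iic, Set.mem_ofPred_eq]
    refine ⟨expo_le_expo n hmu.1, ?_⟩
    rintro ⟨j, h, h1⟩
    simp only [expo_apply] at h1
    have h2 := hmu.2 j
    omega
  · intro γ hγ himg
    obtain ⟨hγ, hc⟩ := Finset.mem_filter.1 hγ
    rw [Finset.mem_Iic] at hγ
    exfalso
    apply himg
    -- The surviving exponents interlace with λ + δ; subtracting δ turns this into the horizontal
    -- strip condition.
    have hc' : ∀ j (h : j + 1 < n), expo n lam ⟨j + 1, h⟩ < γ ⟨j, Nat.lt_of_succ_lt h⟩ := by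
      intro j h
      by_contra! h1
      exact hc ⟨j, h, h1⟩
    have hanti : StrictAnti γ := by
      intro i j hij
      have hij' : (i : ℕ) < j := hij
      have h1 := hc' i (by omega)
      have h2 : expo n lam j ≤ expo n lam ⟨i + 1, by omega⟩ :=
        (expo_strictAnti n lam).antitone (Fin.mk_le_mk.2 hij')
      exact ((hγ j).trans h2).trans_lt h1
    obtain ⟨mu, hm, he⟩ := exists_expo_eq hanti
    refine ⟨mu, ?_, he⟩
    rw [Finset.mem_coe, mem_hstrips, hStrip_iff_rowLen]
    refine ⟨le_of_expo_le hm (he ▸ hγ), fun i => ?_⟩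
    by_cases hi : i + 1 < n
    · have h1 := hc' i hi
      rw [← he] at h1
      simp only [expo_apply] at h1
      omega
    · rw [colLen_zero_le_iff.1 hl (i + 1) (by omega)]
      exact Nat.zero_le _
  · intro mu hmu
    rw [degree_expo_sub hl (mem_hstrips.1 hmu).1]

end

end DoublySymmetric

/-! ### Alternants, the Cauchy identity and the bialternant formula -/

namespace DoublySymmetric

noncomputable section

open MvPowerSeries

variable {R : Type*} [CommRing R] {n : ℕ}

/-! ### Alternants -/

/-- The alternant `det (z_i ^ α_j)`. -/
def alternant (z : Fin n → R) (α : Fin n →₀ ℕ) : R := (Matrix.of fun i j => z i ^ α j).det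

theorem alternant_eq_sum (z : Fin n → R) (α : Fin n →₀ ℕ) :
    alternant z α = ∑ σ : Equiv.Perm (Fin n),
      ((Equiv.Perm.sign σ : ℤ) : R) * ∏ i, z (σ i) ^ α i := by
  rw [alternant, Matrix.det_apply']
  rfl

theorem map_alternant {S : Type*} [CommRing S] (g : R →+* S) (z : Fin n → R) (α : Fin n →₀ ℕ) :
    g (alternant z α) = alternant (fun i => g (z i)) α := by
  simp [alternant_eq_sum]

theorem isAlt_det (A : Fin n → Fin n → MvPowerSeries (Fin n) R)
    (h : ∀ (σ : Equiv.Perm (Fin n)) i j, rename σ (A i j) = A (σ i) j) :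
    IsAlt (Matrix.of A).det := by
  intro σ
  rw [← Matrix.det_permute, AlgHom.map_det]
  congr 1
  ext1 i j
  exact h σ i j

theorem isAlt_alternant (α : Fin n →₀ ℕ) :
    IsAlt (alternant X α : MvPowerSeries (Fin n) R) :=
  isAlt_det _ fun σ i j => by simp

theorem prod_X_pow_eq (α : Fin n →₀ ℕ) (σ : Equiv.Perm (Fin n)) :
    ∏ i, (X (σ i) : MvPowerSeries (Fin n) R) ^ α i = monomial (α.mapDomain σ) 1 := by
  rw [← rename_monomial, monomial_one_eq, Finsupp.prod_fintype _ _ (by simp), map_prod]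
  simp

theorem coeff_alternant [DecidableEq (Fin n →₀ ℕ)] (α β : Fin n →₀ ℕ) :
    coeff β (alternant X α : MvPowerSeries (Fin n) R) = ∑ σ : Equiv.Perm (Fin n),
      if β = α.mapDomain σ then ((Equiv.Perm.sign σ : ℤ) : R) else 0 := by
  rw [alternant_eq_sum, map_sum]
  refine Finset.sum_congr rfl fun σ _ => ?_
  rw [prod_X_pow_eq, coeff_intCast_mul, coeff_monomial]
  split_ifs <;> simp

/-- Such a permutation is strictly increasing, hence the identity. Thus only one term of an
alternant has a strictly decreasing exponent. -/
theorem perm_eq_one_of_mapDomain {α β : Fin n →₀ ℕ} (hα : StrictAnti α) (hβ : StrictAnti β)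
    {σ : Equiv.Perm (Fin n)} (h : β = α.mapDomain σ) : σ = 1 := by
  have h1 : ∀ i, β (σ i) = α i := fun i => by rw [h, mapDomain_perm_apply, σ.symm_apply_apply]
  have h2 : StrictMono σ := by
    intro i j hij
    rw [← hβ.lt_iff_gt, h1, h1]
    exact hα hij
  have h3 : (σ : Fin n → Fin n) = id := by
    refine (h2.range_inj strictMono_id).1 ?_
    rw [σ.surjective.range_eq, Set.range_id]
  exact Equiv.ext fun i => congrFun h3 i

theorem coeff_expo_alternant [DecidableEq YoungDiagram] {lam mu : YoungDiagram}
    (hl : lam.colLen 0 ≤ n) (hm : mu.colLen 0 ≤ n) :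
    coeff (expo n lam) (alternant X (expo n mu) : MvPowerSeries (Fin n) R) =
      if lam = mu then 1 else 0 := by
  classical
  rw [coeff_alternant, Finset.sum_eq_single 1]
  · have h1 : (expo n mu).mapDomain (1 : Equiv.Perm (Fin n)) = expo n mu := Finsupp.mapDomain_id
    rw [h1]
    by_cases h : lam = mu
    · simp [h]
    · rw [if_neg h, if_neg]
      exact fun he => h (expo_injOn n hl hm he)
  · intro σ _ hσ
    rw [if_neg]
    exact fun h => hσ (perm_eq_one_of_mapDomain (expo_strictAnti n mu) (expo_strictAnti n lam) h)
  · simp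

/-! ### Iterated Pieri rules -/

theorem prod_filter_lt_succ {M : Type*} [CommMonoid M] {m : ℕ} (j : Fin m) (G : Fin m → M) :
    ∏ i with i.val < j.val + 1, G i = (∏ i with i.val < j.val, G i) * G j := by
  classical
  have h : Finset.univ.filter (fun i : Fin m => i.val < j.val + 1) =
      insert j (Finset.univ.filter (fun i : Fin m => i.val < j.val)) := by
    ext i
    simp only [Finset.mem_filter, Finset.mem_univ, true_and, Finset.mem_insert, Fin.ext_iff]
    omega
  rw [h, Finset.prod_insert (by simp), mul_comm]

theorem rename_prod_finset {ι : Type*} {G : ι → MvPowerSeries (Fin n) R} {σ : Equiv.Perm (Fin n)}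
    (h : ∀ j, rename σ (G j) = G j) (s : Finset ι) :
    rename σ (∏ j ∈ s, G j) = ∏ j ∈ s, G j := by
  rw [map_prod]
  exact Finset.prod_congr rfl fun j _ => h j

/-- Row `i` of the Cauchy matrix has the common denominator ∏_k (1 - y_k x_i); pulling it out leaves
a matrix of polynomials. -/
theorem det_geom_eq (y : Fin n → R) :
    (Matrix.of fun i j => geom i (y j)).det =
      (Matrix.of fun i j => ∏ k ∈ Finset.univ.erase j,
        (1 - C (y k) * X i : MvPowerSeries (Fin n) R)).det * ∏ j, hSeries n (y j) := by
  have h1 : ∏ j, hSeries n (y j) = ∏ i, ∏ j, geom i (y j) := by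
    unfold hSeries
    exact Finset.prod_comm
  rw [h1, mul_comm, ← Matrix.det_mul_column]
  congr 1
  ext1 i j
  simp only [Matrix.of_apply]
  rw [← Finset.mul_prod_erase _ _ (Finset.mem_univ j), mul_assoc, ← Finset.prod_mul_distrib]
  simp [geom_mul]

theorem coeff_det_sepSeries (g : Fin n → Fin n → ℕ → R) (β : Fin n →₀ ℕ) :
    coeff β (Matrix.of fun i j => sepSeries i (g i j)).det =
      ∑ σ : Equiv.Perm (Fin n), ((Equiv.Perm.sign σ : ℤ) : R) * ∏ i, g i (σ i) (β i) := by
  rw [← Matrix.det_transpose, Matrix.det_apply', map_sum]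
  refine Finset.sum_congr rfl fun σ _ => ?_
  rw [coeff_intCast_mul]
  congr 1
  exact coeff_prod_univ_sepSeries _ _

variable [Algebra ℂ R]

theorem coeff_expo_mul_prod_hSeries {F : MvPowerSeries (Fin n) R} (hF : IsAlt F) {m : ℕ}
    (y : Fin m → R) {lam : YoungDiagram} (hl : lam.colLen 0 ≤ n) :
    coeff (expo n lam) (F * ∏ j, hSeries n (y j)) =
      ∑ mu ∈ below lam, skewSchurAt lam mu y * coeff (expo n mu) F := by
  have h := sum_skewSchurAt_of_hstrips (P := fun lam => lam.colLen 0 ≤ n)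
    (fun _ _ h => colLen_zero_mono h) m y
    -- Partial products bring in one variable at a time, each step being a single Pieri rule.
    (fun k lam => coeff (expo n lam) (F * ∏ j with j.val < k, hSeries n (y j))) ?_ lam hl
  · simpa using h
  · intro j lam hl
    rw [prod_filter_lt_succ, ← mul_assoc, coeff_expo_mul_hSeries _ _ hl]
    exact hF.mul fun σ => rename_prod_finset (fun j => rename_hSeries _ σ) _

/-- The same iteration runs on conjugate diagrams, where vertical strips become horizontal; the sum
is transposed back at the end. -/
theorem coeff_expo_mul_prod_eSeries {F : MvPowerSeries (Fin n) R} (hF : IsAlt F) {m : ℕ}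
    (y : Fin m → R) {lam : YoungDiagram} (hl : lam.colLen 0 ≤ n) :
    coeff (expo n lam) (F * ∏ j, eSeries n (y j)) =
      ∑ mu ∈ below lam, skewSchurAt lam.transpose mu.transpose y * coeff (expo n mu) F := by
  have h := sum_skewSchurAt_of_hstrips (P := fun lam => lam.transpose.colLen 0 ≤ n)
    (fun _ _ h => colLen_zero_mono (YoungDiagram.transpose_mono h)) m y
    (fun k lam => coeff (expo n lam.transpose) (F * ∏ j with j.val < k, eSeries n (y j))) ?_
    lam.transpose (by rwa [YoungDiagram.transpose_transpose])
  · simp only [YoungDiagram.transpose_transpose, Fin.is_lt, Finset.filter_true,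
      Nat.not_lt_zero, Finset.filter_false, Finset.prod_empty, mul_one] at h
    rw [h]
    refine Finset.sum_bij' (fun mu _ => mu.transpose) (fun mu _ => mu.transpose) ?_ ?_ ?_ ?_ ?_
    · intro mu hmu
      rw [mem_below] at *
      exact (YoungDiagram.transpose_mono hmu).trans (YoungDiagram.transpose_transpose lam).le
    · intro mu hmu
      rw [mem_below] at *
      exact YoungDiagram.transpose_mono hmu
    · simp
    · simp
    · simp
  · intro j lam hl
    rw [prod_filter_lt_succ, ← mul_assoc, coeff_expo_mul_eSeries _ _ hl]
    exact hF.mul fun σ => rename_prod_finset (fun j => rename_eSeries _ σ) _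

theorem colLen_bot_le (n : ℕ) : (⊥ : YoungDiagram).colLen 0 ≤ n := by
  rw [colLen_zero_le_iff]
  intro i _
  by_contra h
  exact YoungDiagram.notMem_bot (i, 0)
    (YoungDiagram.mem_iff_lt_rowLen.2 (Nat.pos_of_ne_zero h))

/-- In the iterated Pieri sum only `mu = ⊥` survives, because a_δ has no other coefficient at an
exponent μ + δ. This is the classical Cauchy identity read at λ + δ. -/
theorem coeff_expo_alternant_mul_prod_hSeries {m : ℕ} (y : Fin m → R) {lam : YoungDiagram}
    (hl : lam.colLen 0 ≤ n) :
    coeff (expo n lam) (alternant X (expo n ⊥) * ∏ j, hSeries n (y j)) =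
      skewSchurAt lam ⊥ y := by
  classical
  rw [coeff_expo_mul_prod_hSeries (isAlt_alternant _) y hl, Finset.sum_eq_single ⊥]
  · rw [coeff_expo_alternant (colLen_bot_le n) (colLen_bot_le n), if_pos rfl, mul_one]
  · intro mu hmu hne
    rw [coeff_expo_alternant (colLen_zero_mono (mem_below.1 hmu) hl) (colLen_bot_le n),
      if_neg hne, mul_zero]
  · intro h
    exact absurd (mem_below.2 bot_le) h

/-- The Cauchy identity for doubly Schur polynomials, read off at one exponent. -/
theorem coeff_expo_alternant_mul_kernel {m : ℕ} (y : Fin m → R) {lam : YoungDiagram}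
    (hl : lam.colLen 0 ≤ n) :
    coeff (expo n lam) (alternant X (expo n ⊥) *
        ((∏ j, hSeries n (y j)) * ∏ j, eSeries n (y j))) =
      ∑ mu ∈ below lam, skewSchurAt mu ⊥ y * skewSchurAt lam.transpose mu.transpose y := by
  rw [← mul_assoc, coeff_expo_mul_prod_eSeries _ y hl]
  · refine Finset.sum_congr rfl fun mu hmu => ?_
    rw [coeff_expo_alternant_mul_prod_hSeries y (colLen_zero_mono (mem_below.1 hmu) hl), mul_comm]
  · exact (isAlt_alternant _).mul fun σ => rename_prod_finset (fun j => rename_hSeries _ σ) _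

/-! ### The bialternant formula -/

/-- The coefficient of det (1/(1 - y_j x_i)) at λ + δ is computed twice. Expanding the geometric
series gives the alternant in `y`. Clearing denominators gives a numerator `F` times ∏ 1/(1 - y_j
x_i), where `F` is a scalar multiple of a_δ(x), so the Cauchy identity gives that scalar times
S_λ(y). The case of the empty partition identifies the scalar. -/
theorem alternant_expo_eq (y : Fin n → R) {lam : YoungDiagram} (hl : lam.colLen 0 ≤ n) :
    alternant y (expo n lam) = alternant y (expo n ⊥) * skewSchurAt lam ⊥ y := by
  classical
  set F : MvPowerSeries (Fin n) R := (Matrix.of fun i j => ∏ k ∈ Finset.univ.erase j,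
    (1 - C (y k) * X i : MvPowerSeries (Fin n) R)).det with hF
  have hFalt : IsAlt F := isAlt_det _ fun σ i j => by simp
  have hF0 : ∀ β : Fin n →₀ ℕ, (∃ i, n ≤ β i) → coeff β F = 0 := by
    rintro β ⟨i, hi⟩
    choose g hg hs using fun i j : Fin n =>
      exists_prod_one_sub_eq_sepSeries i y (Finset.univ.erase j)
    simp only [hF, hs]
    rw [coeff_det_sepSeries]
    refine Finset.sum_eq_zero fun σ _ => ?_
    rw [Finset.prod_eq_zero (Finset.mem_univ i), mul_zero]
    apply hg
    rw [Finset.card_erase_of_mem (Finset.mem_univ _), Finset.card_univ, Fintype.card_fin]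
    have := i.2
    omega
  -- `F` has degree below `n` in each variable, while a nonempty μ makes the first entry of μ + δ at
  -- least `n`.
  have hFeq : F = C (coeff (expo n ⊥) F) * alternant X (expo n ⊥) := by
    rw [← sub_eq_zero]
    refine (hFalt.sub ((isAlt_alternant _).C_mul _)).eq_zero fun mu hmu => ?_
    rw [map_sub, coeff_C_mul, coeff_expo_alternant hmu (colLen_bot_le n)]
    by_cases h : mu = ⊥
    · rw [if_pos h, h, mul_one, sub_self]
    · rw [if_neg h, mul_zero, sub_zero]
      apply hF0
      have hr : mu.rowLen 0 ≠ 0 := by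
        intro h0
        apply h
        rw [eq_bot_iff, le_iff_rowLen]
        intro i
        have := mu.rowLen_anti 0 i (Nat.zero_le i)
        omega
      have hn : 0 < n := by
        by_contra! hn
        exact hr (colLen_zero_le_iff.1 hmu 0 hn)
      refine ⟨⟨0, hn⟩, ?_⟩
      simp only [expo_apply]
      omega
  have key : ∀ mu : YoungDiagram, mu.colLen 0 ≤ n →
      alternant y (expo n mu) = coeff (expo n ⊥) F * skewSchurAt mu ⊥ y := by
    intro mu hmu
    rw [← coeff_expo_alternant_mul_prod_hSeries y hmu, ← coeff_C_mul, ← mul_assoc, ← hFeq, hF,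
      ← det_geom_eq]
    unfold geom
    rw [coeff_det_sepSeries, alternant_eq_sum]
  have h0 := key ⊥ (colLen_bot_le n)
  rw [skewSchurAt_self, mul_one] at h0
  rw [key lam hl, h0]

end

end DoublySymmetric

/-! ### Schur coefficients, and the Schur expansion of the kernel -/

namespace DoublySymmetric

noncomputable section

/-! ### Schur coefficients of symmetric polynomials -/

/-- The Vandermonde determinant `det (x_i ^ (n - j))`. -/
def vandermondePoly (n : ℕ) : MvPolynomial (Fin n) ℂ := alternant MvPolynomial.X (expo n ⊥)

theorem coe_alternant {n : ℕ} (α : Fin n →₀ ℕ) :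
    ((alternant MvPolynomial.X α : MvPolynomial (Fin n) ℂ) : MvPowerSeries (Fin n) ℂ) =
      alternant MvPowerSeries.X α := by
  have := map_alternant (MvPolynomial.coeToMvPowerSeries.ringHom (R := ℂ))
    (MvPolynomial.X : Fin n → MvPolynomial (Fin n) ℂ) α
  simpa using this

theorem schur_mul_vandermondePoly {n : ℕ} {lam : YoungDiagram} (hl : lam.colLen 0 ≤ n) :
    schur lam n * vandermondePoly n = alternant MvPolynomial.X (expo n lam) := by
  rw [mul_comm, schur, skewSchur_eq, vandermondePoly, ← alternant_expo_eq _ hl]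

theorem coeff_expo_alternant_poly {n : ℕ} [DecidableEq YoungDiagram] {lam mu : YoungDiagram}
    (hl : lam.colLen 0 ≤ n) (hm : mu.colLen 0 ≤ n) :
    MvPolynomial.coeff (expo n lam)
      (alternant MvPolynomial.X (expo n mu) : MvPolynomial (Fin n) ℂ) =
      if lam = mu then 1 else 0 := by
  rw [← MvPolynomial.coeff_coe, coe_alternant, coeff_expo_alternant hl hm]

theorem schurComb_mul_vandermondePoly (n : ℕ) (c : PartsLE n →₀ ℂ) :
    schurComb n c * vandermondePoly n =
      c.sum fun lam a => a • alternant MvPolynomial.X (expo n lam.1) := by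
  rw [schurComb, Finsupp.linearCombination_apply, Finsupp.sum_mul]
  refine Finsupp.sum_congr fun lam _ => ?_
  rw [smul_mul_assoc, schur_mul_vandermondePoly lam.2]

/-- Multiplication by the Vandermonde determinant turns Schur polynomials into alternants, which
have disjoint monomials; this gives both linear independence and a formula for the coefficients. -/
theorem coeff_schurComb_mul (n : ℕ) (c : PartsLE n →₀ ℂ) (mu : PartsLE n) :
    MvPolynomial.coeff (expo n mu.1) (schurComb n c * vandermondePoly n) = c mu := by
  classical
  rw [schurComb_mul_vandermondePoly, Finsupp.sum, MvPolynomial.coeff_sum]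
  simp only [MvPolynomial.coeff_smul, smul_eq_mul]
  rw [Finset.sum_eq_single mu]
  · rw [coeff_expo_alternant_poly mu.2 mu.2, if_pos rfl, mul_one]
  · intro lam _ hne
    rw [coeff_expo_alternant_poly mu.2 lam.2, if_neg fun h => hne (Subtype.ext h.symm), mul_zero]
  · intro h
    rw [Finsupp.notMem_support_iff.1 h, zero_mul]

theorem ker_schurComb (n : ℕ) : LinearMap.ker (schurComb n) = ⊥ := by
  rw [LinearMap.ker_eq_bot']
  intro c hc
  ext mu
  rw [← coeff_schurComb_mul, hc]
  simp

theorem vandermondePoly_ne_zero (n : ℕ) : vandermondePoly n ≠ 0 := by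
  classical
  intro h
  have h1 := coeff_expo_alternant_poly (colLen_bot_le n) (colLen_bot_le n)
  rw [if_pos rfl] at h1
  change MvPolynomial.coeff _ (vandermondePoly n) = 1 at h1
  rw [h] at h1
  simp at h1

theorem isAlt_mul_vandermondePoly {n : ℕ} (f : Sym n) :
    IsAlt ((f.1 * vandermondePoly n : MvPolynomial (Fin n) ℂ) : MvPowerSeries (Fin n) ℂ) := by
  rw [MvPolynomial.coe_mul, mul_comm]
  refine IsAlt.mul ?_ fun σ => ?_
  · rw [vandermondePoly, coe_alternant]
    exact isAlt_alternant _
  · rw [MvPowerSeries.rename_coe]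
    congr 1
    exact f.2 σ

theorem isAlt_schurComb_mul (n : ℕ) (c : PartsLE n →₀ ℂ) :
    IsAlt ((schurComb n c * vandermondePoly n : MvPolynomial (Fin n) ℂ) :
      MvPowerSeries (Fin n) ℂ) := by
  rw [schurComb_mul_vandermondePoly]
  refine Finsupp.induction_linear c ?_ ?_ ?_
  · intro σ
    simp
  · intro c d hc hd σ
    rw [Finsupp.sum_add_index' (by simp) (by intros; rw [add_smul]), MvPolynomial.coe_add,
      map_add, hc, hd, mul_add]
  · intro lam a
    rw [Finsupp.sum_single_index (by simp), MvPolynomial.smul_eq_C_mul, MvPolynomial.coe_mul,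
      MvPolynomial.coe_C, coe_alternant]
    exact (isAlt_alternant _).C_mul a

/-- The coefficients are read off from `f` times the Vandermonde determinant. The two alternating
products then agree at every λ + δ, so they are equal, and the determinant cancels. -/
theorem schurComb_surjective {n : ℕ} (f : Sym n) : ∃ c, schurComb n c = f.1 := by
  have hfin : (Function.support fun lam : PartsLE n =>
      MvPolynomial.coeff (expo n lam.1) (f.1 * vandermondePoly n)).Finite := by
    refine ((f.1 * vandermondePoly n).support.finite_toSet.preimage
      (f := fun lam : PartsLE n => expo n lam.1) ?_).subset ?_
    · intro lam _ mu _ h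
      exact Subtype.ext (expo_injOn n lam.2 mu.2 h)
    · intro lam h
      simpa using h
  refine ⟨Finsupp.ofSupportFinite _ hfin, ?_⟩
  apply mul_right_cancel₀ (vandermondePoly_ne_zero n)
  apply MvPolynomial.coe_injective
  rw [← sub_eq_zero]
  refine ((isAlt_schurComb_mul n _).sub (isAlt_mul_vandermondePoly f)).eq_zero fun lam hl => ?_
  rw [map_sub, MvPolynomial.coeff_coe, MvPolynomial.coeff_coe]
  have := coeff_schurComb_mul n (Finsupp.ofSupportFinite _ hfin) ⟨lam, hl⟩
  simp only at this
  rw [this]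
  exact sub_self _

theorem schurComb_schurCoeff {n : ℕ} (f : Sym n) : schurComb n (schurCoeff n f) = f.1 := by
  obtain ⟨c, hc⟩ := schurComb_surjective f
  simp only [schurCoeff, LinearMap.comp_apply]
  have h : (Sym n).val.toLinearMap f = schurComb n c := hc.symm
  -- The chosen left inverse is a genuine one only because the kernel of `schurComb n` is trivial.
  rw [h, LinearMap.leftInverse_apply_of_inj (ker_schurComb n)]
  exact hc

theorem schurCoeff_apply {n : ℕ} (f : Sym n) (lam : PartsLE n) :
    schurCoeff n f lam = MvPolynomial.coeff (expo n lam.1) (f.1 * vandermondePoly n) := by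
  rw [← coeff_schurComb_mul, schurComb_schurCoeff]

/-! ### Expansion of the kernel -/

/-- Exchange two sets of variables, as a function. -/
def swapVarsFun {σ τ R : Type*} [CommRing R] (F : MvPowerSeries σ (MvPowerSeries τ R)) :
    MvPowerSeries τ (MvPowerSeries σ R) := fun b a => F a b

theorem coeff_coeff_swapVarsFun {σ τ R : Type*} [CommRing R]
    (F : MvPowerSeries σ (MvPowerSeries τ R)) (a : σ →₀ ℕ) (b : τ →₀ ℕ) :
    MvPowerSeries.coeff a (MvPowerSeries.coeff b (swapVarsFun F)) =
      MvPowerSeries.coeff b (MvPowerSeries.coeff a F) := rfl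

/-- Exchange two sets of variables. -/
def swapVars (σ τ R : Type*) [CommRing R] :
    MvPowerSeries σ (MvPowerSeries τ R) →+* MvPowerSeries τ (MvPowerSeries σ R) where
  toFun := swapVarsFun
  map_zero' := rfl
  map_add' _ _ := rfl
  map_one' := by
    classical
    refine MvPowerSeries.ext fun b => MvPowerSeries.ext fun a => ?_
    rw [coeff_coeff_swapVarsFun, MvPowerSeries.coeff_one, MvPowerSeries.coeff_one]
    split_ifs <;> simp_all [MvPowerSeries.coeff_one]
  map_mul' F G := by
    classical
    refine MvPowerSeries.ext fun b => MvPowerSeries.ext fun a => ?_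
    rw [coeff_coeff_swapVarsFun, MvPowerSeries.coeff_mul, MvPowerSeries.coeff_mul, map_sum,
      map_sum]
    simp only [MvPowerSeries.coeff_mul, coeff_coeff_swapVarsFun]
    exact Finset.sum_comm

theorem coeff_coeff_swapVars {σ τ R : Type*} [CommRing R]
    (F : MvPowerSeries σ (MvPowerSeries τ R)) (a : σ →₀ ℕ) (b : τ →₀ ℕ) :
    MvPowerSeries.coeff a (MvPowerSeries.coeff b (swapVars σ τ R F)) =
      MvPowerSeries.coeff b (MvPowerSeries.coeff a F) := rfl

theorem swapVars_X {σ τ R : Type*} [CommRing R] (i : σ) :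
    swapVars σ τ R (MvPowerSeries.X i) = MvPowerSeries.C (MvPowerSeries.X i) := by
  classical
  ext b a
  rw [coeff_coeff_swapVars, MvPowerSeries.coeff_X, MvPowerSeries.coeff_C]
  split_ifs <;> simp_all [MvPowerSeries.coeff_X, MvPowerSeries.coeff_one]

theorem swapVars_C_X {σ τ R : Type*} [CommRing R] (i : τ) :
    swapVars σ τ R (MvPowerSeries.C (MvPowerSeries.X i)) = MvPowerSeries.X i := by
  classical
  ext b a
  rw [coeff_coeff_swapVars, MvPowerSeries.coeff_X, MvPowerSeries.coeff_C]
  split_ifs <;> simp_all [MvPowerSeries.coeff_X, MvPowerSeries.coeff_one]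

/-- View a power series in `y` with coefficients in polynomials in `x` as a power series in `x`. -/
def expandInX (n m : ℕ) : MvPowerSeries (Fin m) (MvPolynomial (Fin n) ℂ) →+*
    MvPowerSeries (Fin n) (MvPowerSeries (Fin m) ℂ) :=
  (swapVars (Fin m) (Fin n) ℂ).comp
    (MvPowerSeries.map (MvPolynomial.coeToMvPowerSeries.ringHom (R := ℂ)))

theorem coeff_coeff_expandInX {n m : ℕ} (F : MvPowerSeries (Fin m) (MvPolynomial (Fin n) ℂ))
    (α : Fin m →₀ ℕ) (β : Fin n →₀ ℕ) :
    MvPowerSeries.coeff α (MvPowerSeries.coeff β (expandInX n m F)) =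
      MvPolynomial.coeff β (MvPowerSeries.coeff α F) := by
  rw [expandInX, RingHom.comp_apply, coeff_coeff_swapVars, MvPowerSeries.coeff_map]
  exact MvPolynomial.coeff_coe _ _

theorem expandInX_X {n m : ℕ} (j : Fin m) :
    expandInX n m (MvPowerSeries.X j) = MvPowerSeries.C (MvPowerSeries.X j) := by
  rw [expandInX, RingHom.comp_apply, MvPowerSeries.map_X, swapVars_X]

theorem expandInX_C_X {n m : ℕ} (i : Fin n) :
    expandInX n m (MvPowerSeries.C (MvPolynomial.X i)) = MvPowerSeries.X i := by
  rw [expandInX, RingHom.comp_apply, MvPowerSeries.map_C,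
    MvPolynomial.coeToMvPowerSeries.ringHom_apply, MvPolynomial.coe_X, swapVars_C_X]

theorem one_sub_mul_invOfUnit {n m : ℕ} (i : Fin n) (j : Fin m) :
    (1 - MvPowerSeries.C (MvPolynomial.X i : MvPolynomial (Fin n) ℂ) * MvPowerSeries.X j) *
      MvPowerSeries.invOfUnit
        (1 - MvPowerSeries.C (MvPolynomial.X i) * MvPowerSeries.X j) 1 = 1 :=
  MvPowerSeries.mul_invOfUnit _ _ (by simp)

/-- Viewed as a series in `x` over the ring of power series in `y`, the kernel is a product to which
the Pieri rules apply with the `y_j` as scalars. -/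
theorem expandInX_kernel (n m : ℕ) :
    expandInX n m (kernel n m) =
      (∏ j : Fin m, hSeries n (MvPowerSeries.X j)) *
        ∏ j : Fin m, eSeries n (MvPowerSeries.X j) := by
  unfold kernel hSeries eSeries
  rw [Finset.prod_comm, map_prod, ← Finset.prod_mul_distrib]
  refine Finset.prod_congr rfl fun j _ => ?_
  rw [map_prod, ← Finset.prod_mul_distrib]
  refine Finset.prod_congr rfl fun i _ => ?_
  rw [map_mul, mul_comm]
  congr 1
  · have h := congrArg (expandInX n m) (one_sub_mul_invOfUnit i j)
    rw [map_mul, map_sub, map_mul, expandInX_C_X, expandInX_X, map_one] at h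
    refine (left_inv_eq_right_inv (geom_mul i _) ?_).symm
    rwa [mul_comm (MvPowerSeries.C _)]
  · rw [map_add, map_mul, expandInX_C_X, expandInX_X, map_one, mul_comm]

theorem expandInX_C_vandermondePoly (n m : ℕ) :
    expandInX n m (MvPowerSeries.C (vandermondePoly n)) =
      alternant MvPowerSeries.X (expo n ⊥) := by
  have h := map_alternant ((expandInX n m).comp MvPowerSeries.C)
    (MvPolynomial.X : Fin n → MvPolynomial (Fin n) ℂ) (expo n ⊥)
  rw [RingHom.comp_apply] at h
  rw [vandermondePoly, h]
  simp only [RingHom.comp_apply, expandInX_C_X]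

theorem coe_doublySchur (lam : YoungDiagram) (m : ℕ) :
    (doublySchur lam m : MvPowerSeries (Fin m) ℂ) = ∑ mu ∈ below lam,
      skewSchurAt mu ⊥ MvPowerSeries.X *
        skewSchurAt lam.transpose mu.transpose MvPowerSeries.X := by
  have hc : ∀ lam mu : YoungDiagram,
      MvPolynomial.coeToMvPowerSeries.ringHom (skewSchurAt lam mu
        (MvPolynomial.X : Fin m → MvPolynomial (Fin m) ℂ)) = skewSchurAt lam mu MvPowerSeries.X := by
    intro lam mu
    rw [map_skewSchurAt]
    simp
  rw [← MvPolynomial.coeToMvPowerSeries.ringHom_apply]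
  unfold doublySchur schur
  rw [map_sum]
  simp only [skewSchur_eq, map_mul, hc]
  rfl

/-- The Cauchy identity for DS_λ: the Schur coefficient is a coefficient of a_δ times the kernel,
evaluated by `coeff_expo_alternant_mul_kernel` after exchanging the roles of `x` and `y`. -/
theorem schurCoeff_kernelCoeff {n m : ℕ} (α : Fin m →₀ ℕ) (lam : PartsLE n) :
    schurCoeff n (kernelCoeff n m α) lam = MvPolynomial.coeff α (doublySchur lam.1 m) := by
  rw [schurCoeff_apply]
  have h1 : (kernelCoeff n m α).1 * vandermondePoly n =
      MvPowerSeries.coeff α (MvPowerSeries.C (vandermondePoly n) * kernel n m) := by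
    rw [MvPowerSeries.coeff_C_mul, mul_comm]
    rfl
  rw [h1, ← coeff_coeff_expandInX, map_mul, expandInX_C_vandermondePoly, expandInX_kernel,
    coeff_expo_alternant_mul_kernel _ lam.2, ← coe_doublySchur, MvPolynomial.coeff_coe]

theorem coeff_doubling {n m : ℕ} (f : Sym n) (α : Fin m →₀ ℕ) :
    MvPolynomial.coeff α (doubling n m f) = schurInner n f (kernelCoeff n m α) := by
  rw [doubling, LinearMap.comp_apply, Finsupp.linearCombination_apply, schurInner, Finsupp.sum,
    Finsupp.sum, MvPolynomial.coeff_sum]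
  refine Finset.sum_congr rfl fun lam _ => ?_
  rw [MvPolynomial.coeff_smul, smul_eq_mul, schurCoeff_kernelCoeff]

theorem coe_doubling_eq_innerKernel {n m : ℕ} (f : Sym n) :
    (doubling n m f : MvPowerSeries (Fin m) ℂ) = innerKernel n m f := by
  ext α
  rw [MvPolynomial.coeff_coe, coeff_doubling]
  rfl

end

end DoublySymmetric

/-! ### Absolutely summable series and Weyl orthogonality on the torus -/

namespace DoublySymmetric

noncomputable section

/-! ### Absolutely summable power series -/

section AbsHasSum

variable {A : Type*} [NormedCommRing A] {m : ℕ}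

/-- The coefficients of `F` are absolutely summable, with sum `v`. -/
def AbsHasSum (F : MvPowerSeries (Fin m) A) (v : A) : Prop :=
  (Summable fun α => ‖MvPowerSeries.coeff α F‖) ∧ HasSum (fun α => MvPowerSeries.coeff α F) v

/-- Cauchy product: the norms of the product's coefficients are dominated by the convolution of the
two summable families of norms. -/
theorem AbsHasSum.mul [CompleteSpace A] {F G : MvPowerSeries (Fin m) A} {v w : A}
    (hF : AbsHasSum F v) (hG : AbsHasSum G w) : AbsHasSum (F * G) (v * w) := by
  classical
  have hp := Summable.mul_of_nonneg (f := fun α => ‖MvPowerSeries.coeff α F‖)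
    (g := fun α => ‖MvPowerSeries.coeff α G‖) hF.1 hG.1 (fun _ => norm_nonneg _)
    (fun _ => norm_nonneg _)
  have hn := summable_sum_mul_antidiagonal_of_summable_mul
    (f := fun α => ‖MvPowerSeries.coeff α F‖) (g := fun α => ‖MvPowerSeries.coeff α G‖) hp
  have hs : Summable fun α => ‖MvPowerSeries.coeff α (F * G)‖ := by
    refine hn.of_nonneg_of_le (fun _ => norm_nonneg _) fun α => ?_
    rw [MvPowerSeries.coeff_mul]
    exact norm_sum_le_of_le _ fun p _ => norm_mul_le _ _
  refine ⟨hs, ?_⟩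
  have ht := hF.2.summable.tsum_mul_tsum_eq_tsum_sum_antidiagonal hG.2.summable
    (summable_mul_of_summable_norm hF.1 hG.1)
  rw [hF.2.tsum_eq, hG.2.tsum_eq] at ht
  rw [ht]
  simp only [← MvPowerSeries.coeff_mul]
  exact hs.of_norm.hasSum

theorem absHasSum_sepSeries (j : Fin m) {g : ℕ → A} {v : A} (hs : Summable fun k => ‖g k‖)
    (hg : HasSum g v) : AbsHasSum (sepSeries j g) v := by
  have hinj : Function.Injective (fun k : ℕ => Finsupp.single j k) := Finsupp.single_injective j
  have h0 : ∀ α ∉ Set.range (fun k : ℕ => Finsupp.single j k),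
      MvPowerSeries.coeff α (sepSeries j g) = 0 := by
    intro α hα
    rw [coeff_sepSeries, if_neg]
    exact fun h => hα ⟨_, (Finsupp.support_subset_singleton.1 h).symm⟩
  have h1 : ∀ k, MvPowerSeries.coeff (Finsupp.single j k) (sepSeries j g) = g k := by
    intro k
    rw [coeff_sepSeries, if_pos Finsupp.support_single_subset, Finsupp.single_eq_same]
  constructor
  · rw [← hinj.summable_iff]
    · simpa [Function.comp_def, h1] using hs
    · intro α hα
      rw [h0 α hα, norm_zero]
  · rw [← hinj.hasSum_iff h0]
    simpa [Function.comp_def, h1] using hg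

theorem absHasSum_one_add (j : Fin m) (a : A) :
    AbsHasSum (1 + MvPowerSeries.C a * MvPowerSeries.X j) (1 + a) := by
  rw [one_add_C_mul_X_eq]
  have h0 : ∀ k ∉ Finset.range 2, (if k ≤ 1 then a ^ k else 0) = 0 := by
    intro k hk
    rw [Finset.mem_range] at hk
    exact if_neg (by omega)
  refine absHasSum_sepSeries j ?_ ?_
  · refine summable_of_ne_finset_zero (s := Finset.range 2) fun k hk => ?_
    rw [h0 k hk, norm_zero]
  · have := hasSum_sum_of_ne_finset_zero (L := .unconditional _) h0
    simpa [Finset.sum_range_succ] using this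

theorem absHasSum_geom [CompleteSpace A] (j : Fin m) {a : A} (ha : ‖a‖ < 1) :
    AbsHasSum (geom j a) (∑' k : ℕ, a ^ k) :=
  absHasSum_sepSeries j (summable_norm_geometric_of_norm_lt_one ha)
    (summable_norm_geometric_of_norm_lt_one ha).of_norm.hasSum

theorem absHasSum_prod [CompleteSpace A] {ι : Type*} (s : Finset ι)
    {F : ι → MvPowerSeries (Fin m) A} {v : ι → A} (h : ∀ i ∈ s, AbsHasSum (F i) (v i)) : AbsHasSum (∏ i ∈ s, F i) (∏ i ∈ s, v i) := by
  classical
  induction s using Finset.induction_on with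
  | empty =>
    have h1 : AbsHasSum (1 : MvPowerSeries (Fin m) A) 1 := by
      have h2 : ∀ α ∉ ({0} : Finset (Fin m →₀ ℕ)),
          MvPowerSeries.coeff α (1 : MvPowerSeries (Fin m) A) = 0 := by
        intro α hα
        rw [MvPowerSeries.coeff_one, if_neg (by simpa using hα)]
      constructor
      · refine summable_of_ne_finset_zero (s := {0}) fun k hk => ?_
        rw [h2 k hk, norm_zero]
      · have := hasSum_sum_of_ne_finset_zero (L := .unconditional _) h2
        simpa using this
    simpa using h1
  | insert a s ha ih =>
    rw [Finset.prod_insert ha, Finset.prod_insert ha]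
    exact (h a (Finset.mem_insert_self a s)).mul
      (ih fun i hi => h i (Finset.mem_insert_of_mem hi))

end AbsHasSum

/-! ### Fourier analysis on the torus -/

open MeasureTheory Complex

/-- Lebesgue measure on the box `[0, 2π]^n`. -/
def boxMeasure (n : ℕ) : Measure (Fin n → ℝ) :=
  volume.restrict (Set.Icc 0 fun _ => 2 * Real.pi)

instance (n : ℕ) : IsFiniteMeasure (boxMeasure n) :=
  ⟨by rw [boxMeasure, Measure.restrict_apply_univ]; exact measure_Icc_lt_top⟩

/-- Bounded continuous functions of the angles. -/
abbrev AngleFun (n : ℕ) : Type := BoundedContinuousFunction (Fin n → ℝ) ℂ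

/-- The coordinate `exp (i θ_j)`. -/
def angleExp {n : ℕ} (j : Fin n) : AngleFun n :=
  BoundedContinuousFunction.ofNormedAddCommGroup (fun θ => exp (θ j * I)) (by fun_prop) 1
    fun θ => (norm_exp_ofReal_mul_I _).le

/-- The inverse coordinate `exp (-i θ_j)`. -/
def angleExpInv {n : ℕ} (j : Fin n) : AngleFun n :=
  BoundedContinuousFunction.ofNormedAddCommGroup (fun θ => exp (-(θ j * I))) (by fun_prop) 1
    fun θ => by
      have := norm_exp_ofReal_mul_I (-(θ j))
      rw [ofReal_neg, neg_mul] at this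
      exact this.le

@[simp] theorem angleExp_apply {n : ℕ} (j : Fin n) (θ : Fin n → ℝ) :
    angleExp j θ = exp (θ j * I) := rfl

@[simp] theorem angleExpInv_apply {n : ℕ} (j : Fin n) (θ : Fin n → ℝ) :
    angleExpInv j θ = exp (-(θ j * I)) := rfl

theorem norm_angleExpInv_le {n : ℕ} (j : Fin n) : ‖(angleExpInv j : AngleFun n)‖ ≤ 1 :=
  BoundedContinuousFunction.norm_ofNormedAddCommGroup_le _ zero_le_one _

/-- Evaluation at an angle. -/
def evalAngle {n : ℕ} (θ : Fin n → ℝ) : AngleFun n →ₐ[ℂ] ℂ where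
  toFun g := g θ
  map_one' := rfl
  map_mul' _ _ := rfl
  map_zero' := rfl
  map_add' _ _ := rfl
  commutes' _ := by simp [BoundedContinuousFunction.algebraMap_apply]

theorem evalAngle_apply {n : ℕ} (θ : Fin n → ℝ) (g : AngleFun n) : evalAngle θ g = g θ := rfl

/-- The restriction of a polynomial to the torus. -/
def onTorus (n : ℕ) : MvPolynomial (Fin n) ℂ →ₐ[ℂ] AngleFun n := MvPolynomial.aeval angleExp

/-- The restriction to the torus of a polynomial in the inverse coordinates. -/
def onTorusInv (n : ℕ) : MvPolynomial (Fin n) ℂ →ₐ[ℂ] AngleFun n :=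
  MvPolynomial.aeval angleExpInv

theorem onTorus_apply {n : ℕ} (p : MvPolynomial (Fin n) ℂ) (θ : Fin n → ℝ) :
    onTorus n p θ = MvPolynomial.eval (fun i => exp (θ i * I)) p := by
  rw [← evalAngle_apply, onTorus, ← AlgHom.comp_apply, MvPolynomial.comp_aeval]
  rfl

theorem onTorusInv_apply {n : ℕ} (p : MvPolynomial (Fin n) ℂ) (θ : Fin n → ℝ) :
    onTorusInv n p θ = MvPolynomial.eval (fun i => exp (-(θ i * I))) p := by
  rw [← evalAngle_apply, onTorusInv, ← AlgHom.comp_apply, MvPolynomial.comp_aeval]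
  rfl

/-- The mean over the torus. -/
def torusMean (n : ℕ) : AngleFun n →L[ℂ] ℂ :=
  ((2 * Real.pi : ℂ) ^ n)⁻¹ • LinearMap.mkContinuous
    { toFun := fun g => ∫ θ, g θ ∂(boxMeasure n)
      map_add' := fun g h => integral_add (g.integrable _) (h.integrable _)
      map_smul' := fun c _ => integral_smul c _ }
    ((boxMeasure n).real Set.univ) fun g => g.norm_integral_le_mul_norm _

theorem torusMean_apply {n : ℕ} (g : AngleFun n) :
    torusMean n g = ((2 * Real.pi : ℂ) ^ n)⁻¹ * ∫ θ, g θ ∂(boxMeasure n) := rfl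

theorem integral_exp_int_mul (k : ℤ) :
    ∫ t in Set.Icc (0 : ℝ) (2 * Real.pi), exp (k * (t * I)) =
      if k = 0 then (2 * Real.pi : ℂ) else 0 := by
  rw [integral_Icc_eq_integral_Ioc,
    ← intervalIntegral.integral_of_le (by positivity : (0 : ℝ) ≤ 2 * Real.pi)]
  by_cases hk : k = 0
  · simp [hk]
  · rw [if_neg hk]
    have h1 : ∀ t : ℝ, (k : ℂ) * (t * I) = (k * I) * t := fun t => by ring
    simp only [h1]
    rw [integral_exp_mul_complex (mul_ne_zero (Int.cast_ne_zero.2 hk) I_ne_zero)]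
    have h2 : (k : ℂ) * I * ((2 * Real.pi : ℝ) : ℂ) = k * (2 * Real.pi * I) := by
      push_cast
      ring
    rw [h2, exp_int_mul_two_pi_mul_I]
    simp

theorem torusMean_monomial {n : ℕ} (α β : Fin n →₀ ℕ) [Decidable (α = β)] :
    torusMean n ((∏ i, angleExp i ^ α i) * ∏ i, angleExpInv i ^ β i) =
      if α = β then 1 else 0 := by
  rw [torusMean_apply]
  have h1 : ∀ θ : Fin n → ℝ, ((∏ i, angleExp i ^ α i) * ∏ i, angleExpInv i ^ β i : AngleFun n) θ =
      ∏ i, exp ((((α i : ℤ) - β i : ℤ) : ℂ) * (θ i * I)) := by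
    intro θ
    rw [← evalAngle_apply, map_mul, map_prod, map_prod, ← Finset.prod_mul_distrib]
    refine Finset.prod_congr rfl fun i _ => ?_
    rw [map_pow, map_pow]
    rw [evalAngle_apply, evalAngle_apply, angleExp_apply, angleExpInv_apply, ← exp_nat_mul, ← exp_nat_mul, ← exp_add]
    congr 1
    push_cast
    ring
  simp only [h1]
  have h2 : boxMeasure n =
      Measure.pi fun _ : Fin n => (volume : Measure ℝ).restrict (Set.Icc 0 (2 * Real.pi)) := by
    rw [boxMeasure, ← Measure.restrict_pi_pi, Set.pi_univ_Icc]
    rfl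
  rw [h2, integral_fintype_prod_eq_prod
    (f := fun i (t : ℝ) => exp ((((α i : ℤ) - β i : ℤ) : ℂ) * (t * I)))]
  simp only [integral_exp_int_mul]
  split_ifs with h
  · subst h
    have hpi : (2 * Real.pi : ℂ) ≠ 0 := by simp [Real.pi_ne_zero]
    simp [hpi]
  · obtain ⟨i, hi⟩ : ∃ i, α i ≠ β i := by
      by_contra! hc
      exact h (Finsupp.ext hc)
    rw [Finset.prod_eq_zero (Finset.mem_univ i), mul_zero]
    exact if_neg (sub_ne_zero.2 (Nat.cast_injective.ne hi))

theorem torusMean_prod_mul_aeval {n : ℕ} (α : Fin n →₀ ℕ) (q : MvPolynomial (Fin n) ℂ) :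
    torusMean n ((∏ i, angleExp i ^ α i) * onTorusInv n q) =
      MvPolynomial.coeff α q := by
  classical
  induction q using MvPolynomial.induction_on' with
  | monomial β a =>
    rw [onTorusInv, MvPolynomial.aeval_monomial, MvPolynomial.coeff_monomial,
      Finsupp.prod_fintype _ _ (by simp), mul_left_comm, ← Algebra.smul_def, map_smul,
      torusMean_monomial]
    by_cases h : α = β
    · simp [h]
    · simp [h, Ne.symm h]
  | add p q hp hq => rw [map_add, mul_add, map_add, hp, hq, MvPolynomial.coeff_add]

/-- Each of the n! terms of the determinant extracts the coefficient of `q` at a permuted exponent;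
the sign from `q` cancels the sign from the determinant. -/
theorem torusMean_alternant_mul {n : ℕ} (α : Fin n →₀ ℕ) {q : MvPolynomial (Fin n) ℂ}
    (hq : IsAlt (q : MvPowerSeries (Fin n) ℂ)) :
    torusMean n (onTorus n (alternant MvPolynomial.X α) *
      onTorusInv n q) = n.factorial * MvPolynomial.coeff α q := by
  have h1 := map_alternant (onTorus n).toRingHom
    (MvPolynomial.X : Fin n → MvPolynomial (Fin n) ℂ) α
  have h2 : onTorus n (alternant MvPolynomial.X α : MvPolynomial (Fin n) ℂ) =
      alternant angleExp α := by simpa [onTorus] using h1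
  rw [h2, alternant_eq_sum, Finset.sum_mul, map_sum]
  have h3 : ∀ σ : Equiv.Perm (Fin n), torusMean n (((Equiv.Perm.sign σ : ℤ) : AngleFun n) *
      (∏ i, angleExp (σ i) ^ α i) * onTorusInv n q) =
      MvPolynomial.coeff α q := by
    intro σ
    have h4 : ∏ i, (angleExp (σ i) : AngleFun n) ^ α i =
        ∏ i, angleExp i ^ (α.mapDomain σ) i :=
      Fintype.prod_equiv σ _ _ fun i => by
        rw [mapDomain_perm_apply, σ.symm_apply_apply]
    rw [mul_assoc, ← zsmul_eq_mul, map_zsmul, h4, torusMean_prod_mul_aeval,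
      ← MvPolynomial.coeff_coe, hq.coeff_mapDomain, zsmul_eq_mul, ← mul_assoc, sign_mul_sign,
      one_mul, MvPolynomial.coeff_coe]
  rw [Finset.sum_congr rfl fun σ _ => h3 σ, Finset.sum_const, Finset.card_univ,
    Fintype.card_perm, Fintype.card_fin, nsmul_eq_mul]

/-- Weyl's orthogonality relations. -/
theorem torusMean_mul_vandermondePoly {n : ℕ} (f g : Sym n) :
    torusMean n (onTorus n (f.1 * vandermondePoly n) *
      onTorusInv n (g.1 * vandermondePoly n)) =
        n.factorial * schurInner n f g := by
  rw [← schurComb_schurCoeff f, schurComb_mul_vandermondePoly, schurInner, Finsupp.sum,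
    Finsupp.sum, map_sum, Finset.sum_mul, map_sum, Finset.mul_sum]
  refine Finset.sum_congr rfl fun lam _ => ?_
  rw [map_smul, smul_mul_assoc, map_smul, torusMean_alternant_mul _ (isAlt_mul_vandermondePoly g),
    ← schurCoeff_apply, smul_eq_mul]
  ring

end

end DoublySymmetric

/-! ### The Weyl integral of the kernel -/

namespace DoublySymmetric

noncomputable section

open MeasureTheory Complex

/-! ### The Weyl integrand -/

theorem rowLen_bot (i : ℕ) : (⊥ : YoungDiagram).rowLen i = 0 :=
  colLen_zero_le_iff.1 (colLen_bot_le 0) i (Nat.zero_le i)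

/-- The exponents n - 1 - j reverse the columns of the Vandermonde matrix. The resulting sign
cancels in `prod_one_sub_div_eq`, where it occurs twice. -/
theorem alternant_expo_bot {R : Type*} [CommRing R] {n : ℕ} (z : Fin n → R) :
    alternant z (expo n ⊥) = ((Equiv.Perm.sign (Fin.revPerm : Equiv.Perm (Fin n)) : ℤ) : R) *
      ∏ i, ∏ j ∈ Finset.Ioi i, (z j - z i) := by
  rw [← Matrix.det_vandermonde, ← Matrix.det_permute', alternant]
  congr 1
  ext1 i j
  simp only [Matrix.of_apply, Matrix.submatrix_apply, Matrix.vandermonde_apply, expo_apply,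
    rowLen_bot, id, Fin.revPerm_apply, Fin.val_rev]
  congr 1
  omega

/-- Pairing (i, j) with (j, i): (1 - x_i/x_j)(1 - x_j/x_i) = (x_j - x_i)(x_j⁻¹ - x_i⁻¹). -/
theorem prod_one_sub_div_eq {n : ℕ} {x : Fin n → ℂ} (hx : ∀ i, x i ≠ 0) :
    (∏ i, ∏ j, if i = j then 1 else (1 - x i / x j)) =
      alternant x (expo n ⊥) * alternant (fun i => (x i)⁻¹) (expo n ⊥) := by
  have h1 : (∏ i, ∏ j, if i = j then 1 else (1 - x i / x j)) =
      ∏ i, ∏ j ∈ {i}ᶜ, (1 - x i / x j) := by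
    refine Finset.prod_congr rfl fun i _ => ?_
    rw [← Finset.mul_prod_erase _ _ (Finset.mem_univ i), if_pos rfl, one_mul,
      Finset.compl_singleton]
    refine Finset.prod_congr rfl fun j hj => ?_
    rw [if_neg (Finset.ne_of_mem_erase hj).symm]
  have h2 := Finset.prod_prod_Ioi_mul_eq_prod_prod_off_diag fun j i : Fin n => 1 - x i / x j
  rw [h1, ← h2, alternant_expo_bot, alternant_expo_bot, mul_mul_mul_comm, sign_mul_sign, one_mul,
    ← Finset.prod_mul_distrib]
  refine Finset.prod_congr rfl fun i _ => ?_
  rw [← Finset.prod_mul_distrib]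
  refine Finset.prod_congr rfl fun j _ => ?_
  have hi := hx i
  have hj := hx j
  field_simp

/-- The kernel as a function of the angles, expanded in `y`. -/
def kernelOnTorus (n m : ℕ) (y : Fin m → ℂ) : AngleFun n :=
  ∏ i, ∏ j, ((1 + y j • angleExpInv i) * ∑' k : ℕ, (y j • angleExpInv i) ^ k)

/-- Restrict the coefficients to the torus and rescale the variables. -/
def restrictScale (n m : ℕ) (y : Fin m → ℂ) :
    MvPowerSeries (Fin m) (MvPolynomial (Fin n) ℂ) →+* MvPowerSeries (Fin m) (AngleFun n) :=
  (MvPowerSeries.rescale fun j => algebraMap ℂ (AngleFun n) (y j)).comp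
    (MvPowerSeries.map (onTorusInv n).toRingHom)

theorem coeff_restrictScale {n m : ℕ} (y : Fin m → ℂ)
    (F : MvPowerSeries (Fin m) (MvPolynomial (Fin n) ℂ)) (α : Fin m →₀ ℕ) :
    MvPowerSeries.coeff α (restrictScale n m y F) =
      (∏ j, y j ^ α j) • onTorusInv n (MvPowerSeries.coeff α F) := by
  rw [restrictScale, RingHom.comp_apply, MvPowerSeries.coeff_rescale, MvPowerSeries.coeff_map,
    Finsupp.prod_fintype _ _ (by simp), Algebra.smul_def, map_prod]
  simp only [map_pow]
  rfl

theorem restrictScale_C_mul_X {n m : ℕ} (y : Fin m → ℂ) (i : Fin n) (j : Fin m) :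
    restrictScale n m y (MvPowerSeries.C (MvPolynomial.X i) * MvPowerSeries.X j) =
      MvPowerSeries.C (y j • angleExpInv i) * MvPowerSeries.X j := by
  classical
  ext1 α
  rw [coeff_restrictScale, C_mul_X_eq, C_mul_X_eq, MvPowerSeries.coeff_monomial,
    MvPowerSeries.coeff_monomial]
  split_ifs with h
  · subst h
    rw [Finset.prod_eq_single j]
    · simp [onTorusInv]
    · intro k _ hk
      simp [Finsupp.single_eq_of_ne hk]
    · simp
  · simp

variable {n m : ℕ} {y : Fin m → ℂ}

theorem norm_smul_angleExpInv_lt (hy : ∀ j, ‖y j‖ < 1) (i : Fin n) (j : Fin m) :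
    ‖(y j • angleExpInv i : AngleFun n)‖ < 1 := by
  rw [norm_smul]
  exact (mul_le_of_le_one_right (norm_nonneg _) (norm_angleExpInv_le i)).trans_lt (hy j)

/-- In the sup norm y_j x_i⁻¹ has norm below 1, so each geometric factor is absolutely summable, and
finite products preserve this. -/
theorem absHasSum_kernel (hy : ∀ j, ‖y j‖ < 1) :
    AbsHasSum (restrictScale n m y (kernel n m)) (kernelOnTorus n m y) := by
  unfold kernel kernelOnTorus
  rw [map_prod]
  refine absHasSum_prod _ fun i _ => ?_
  rw [map_prod]
  refine absHasSum_prod _ fun j _ => ?_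
  rw [map_mul]
  refine AbsHasSum.mul ?_ ?_
  · rw [map_add, map_one, restrictScale_C_mul_X]
    exact absHasSum_one_add j _
  · have h := congrArg (restrictScale n m y) (one_sub_mul_invOfUnit i j)
    rw [map_mul, map_sub, restrictScale_C_mul_X, map_one] at h
    rw [← left_inv_eq_right_inv (geom_mul j (y j • angleExpInv i)) h]
    exact absHasSum_geom j (norm_smul_angleExpInv_lt hy i j)

theorem exp_mul_I_sub_ne_zero {w : ℂ} (hw : ‖w‖ < 1) (t : ℝ) : exp (t * I) - w ≠ 0 := by
  intro h
  rw [sub_eq_zero] at h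
  have := norm_exp_ofReal_mul_I t
  rw [h] at this
  exact hw.ne this

theorem kernelOnTorus_apply (hy : ∀ j, ‖y j‖ < 1) (θ : Fin n → ℝ) :
    kernelOnTorus n m y θ =
      ∏ i, ∏ j, (exp (θ i * I) + y j) / (exp (θ i * I) - y j) := by
  rw [← evalAngle_apply, kernelOnTorus, map_prod]
  refine Finset.prod_congr rfl fun i _ => ?_
  rw [map_prod]
  refine Finset.prod_congr rfl fun j _ => ?_
  have h := congrArg (evalAngle θ)
    (geom_series_mul_neg _ (norm_smul_angleExpInv_lt hy i j))
  rw [map_mul, map_sub, map_one, map_smul] at h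
  rw [map_mul, map_add, map_one, map_smul]
  rw [evalAngle_apply θ (angleExpInv i), angleExpInv_apply, exp_neg, smul_eq_mul] at *
  generalize evalAngle θ (∑' k : ℕ, (y j • angleExpInv i) ^ k) = w at *
  have hx := exp_ne_zero (θ i * I)
  have hd := exp_mul_I_sub_ne_zero (hy j) (θ i)
  generalize exp (θ i * I) = x at *
  rw [eq_div_iff hd]
  have h1 : x - y j = x * (1 - y j * x⁻¹) := by field_simp
  have h2 : x + y j = x * (1 + y j * x⁻¹) := by field_simp
  rw [h1, h2]
  linear_combination (1 + y j * x⁻¹) * x * h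

/-- The part of the Weyl integrand that remains after cancelling the volume form. -/
def weylFun (n m : ℕ) (f : Sym n) (y : Fin m → ℂ) : AngleFun n :=
  onTorus n (f.1 * vandermondePoly n) *
    (onTorusInv n (vandermondePoly n) * kernelOnTorus n m y)

/-- The mean is applied term by term to the expansion in `y`. Orthogonality makes the term at `α`
equal to n! times the monomial of Df at `α`; since Df is a polynomial, only finitely many are
nonzero. -/
theorem torusMean_weylFun (f : Sym n) (hy : ∀ j, ‖y j‖ < 1) :
    torusMean n (weylFun n m f y) = n.factorial * MvPolynomial.eval y (doubling n m f) := by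
  have h1 : HasSum (fun α => torusMean n (onTorus n (f.1 * vandermondePoly n) *
      (onTorusInv n (vandermondePoly n) *
        MvPowerSeries.coeff α (restrictScale n m y (kernel n m)))))
      (torusMean n (weylFun n m f y)) :=
    (torusMean n).hasSum (((absHasSum_kernel hy).2.mul_left _).mul_left _)
  have h2 : ∀ α, torusMean n (onTorus n (f.1 * vandermondePoly n) *
      (onTorusInv n (vandermondePoly n) *
        MvPowerSeries.coeff α (restrictScale n m y (kernel n m)))) =
      n.factorial * (MvPolynomial.coeff α (doubling n m f) * ∏ j, y j ^ α j) := by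
    intro α
    rw [coeff_restrictScale, mul_smul_comm, mul_smul_comm, map_smul, ← map_mul,
      mul_comm (vandermondePoly n), coeff_doubling]
    have := torusMean_mul_vandermondePoly f (kernelCoeff n m α)
    change torusMean n (onTorus n _ * onTorusInv n (MvPowerSeries.coeff α (kernel n m) * _)) = _
      at this
    rw [this, smul_eq_mul]
    ring
  simp only [h2] at h1
  refine h1.unique ?_
  rw [MvPolynomial.eval_eq']
  refine HasSum.mul_left _ (hasSum_sum_of_ne_finset_zero fun α hα => ?_)
  rw [MvPolynomial.notMem_support_iff.1 hα, zero_mul]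

theorem weylIntegrand_torusMap (f : Sym n) (hy : ∀ j, ‖y j‖ < 1) (θ : Fin n → ℝ) :
    weylIntegrand n m f y (torusMap 0 (fun _ => 1) θ) =
      ((2 * Real.pi * I) ^ n)⁻¹ * ((n.factorial : ℂ))⁻¹ * weylFun n m f y θ *
        ∏ i, (exp (θ i * I))⁻¹ := by
  have hx : torusMap 0 (fun _ => 1) θ = fun i => exp (θ i * I) := by
    funext i
    simp [torusMap]
  have hV : ∀ z : Fin n → ℂ,
      MvPolynomial.eval z (vandermondePoly n) = alternant z (expo n ⊥) := by
    intro z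
    rw [vandermondePoly, map_alternant]
    simp
  have hW : weylFun n m f y θ = onTorus n (f.1 * vandermondePoly n) θ *
      (onTorusInv n (vandermondePoly n) θ * kernelOnTorus n m y θ) := rfl
  rw [hx, hW, kernelOnTorus_apply hy, onTorus_apply, onTorusInv_apply, map_mul, hV, hV,
    weylIntegrand, weylDensity, prod_one_sub_div_eq fun i => exp_ne_zero _]
  simp only [exp_neg]
  ring

theorem torusIntegrable_weylIntegrand (f : Sym n) (hy : ∀ j, ‖y j‖ < 1) :
    TorusIntegrable (weylIntegrand n m f y) 0 (fun _ => 1) := by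
  have h := (((((2 * Real.pi * I) ^ n)⁻¹ * ((n.factorial : ℂ))⁻¹) •
    (weylFun n m f y * ∏ i, angleExpInv i)).integrable (boxMeasure n))
  refine h.congr (Filter.Eventually.of_forall fun θ => ?_)
  simp only
  rw [weylIntegrand_torusMap f hy, ← evalAngle_apply, map_smul, map_mul, map_prod]
  simp only [evalAngle_apply, angleExpInv_apply, exp_neg, smul_eq_mul]
  ring

theorem torusIntegral_weylIntegrand (f : Sym n) (hy : ∀ j, ‖y j‖ < 1) :
    torusIntegral (weylIntegrand n m f y) 0 (fun _ => 1) =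
      MvPolynomial.eval y (doubling n m f) := by
  have hfac : (n.factorial : ℂ) ≠ 0 := Nat.cast_ne_zero.2 n.factorial_ne_zero
  -- The Jacobian ∏ √-1 x_i cancels ∏ x_i⁻¹ and turns (2π√-1)⁻ⁿ into (2π)⁻ⁿ, the normalisation of
  -- `torusMean`.
  have h : ∀ θ : Fin n → ℝ, (∏ i, ((1 : ℝ) : ℂ) * exp (θ i * I) * I) •
      weylIntegrand n m f y (torusMap 0 (fun _ => 1) θ) =
      ((n.factorial : ℂ))⁻¹ * ((2 * Real.pi : ℂ) ^ n)⁻¹ * weylFun n m f y θ := by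
    intro θ
    have hI : (I : ℂ) ^ n ≠ 0 := pow_ne_zero _ I_ne_zero
    have hE : (∏ i, exp (θ i * I)) ≠ 0 := Finset.prod_ne_zero_iff.2 fun i _ => exp_ne_zero _
    rw [weylIntegrand_torusMap f hy, Finset.prod_inv_distrib]
    simp only [ofReal_one, one_mul, Finset.prod_mul_distrib, Finset.prod_const, Finset.card_univ,
      Fintype.card_fin, smul_eq_mul, mul_pow]
    generalize (∏ i, exp (θ i * I)) = E at hE ⊢
    field_simp
  unfold torusIntegral
  simp only [h]
  rw [integral_const_mul, mul_assoc]
  change _ * torusMean n (weylFun n m f y) = _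
  rw [torusMean_weylFun f hy, inv_mul_cancel_left₀ hfac]

end

end DoublySymmetric

theorem theorem2p11 (n m : ℕ) (f : MvPolynomial.symmetricSubalgebra (Fin n) ℂ) :
    ((DoublySymmetric.doubling n m f : MvPolynomial (Fin m) ℂ) : MvPowerSeries (Fin m) ℂ) =
        DoublySymmetric.innerKernel n m f ∧
      ∀ y : Fin m → ℂ, (∀ j, ‖y j‖ < 1) →
        TorusIntegrable (DoublySymmetric.weylIntegrand n m f y) 0 (fun _ => 1) ∧
          MvPolynomial.eval y (DoublySymmetric.doubling n m f) =
            torusIntegral (DoublySymmetric.weylIntegrand n m f y) 0 (fun _ => 1) :=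
  ⟨DoublySymmetric.coe_doubling_eq_innerKernel f, fun _ hy =>
    ⟨DoublySymmetric.torusIntegrable_weylIntegrand f hy,
      (DoublySymmetric.torusIntegral_weylIntegrand f hy).symm⟩⟩
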